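/- Let $F_2$ be the free group of rank two. For a group $G$ write $\widehat G$ for its profinite completion, and for a profinite group $P$ write $\mathrm{Aut}\,P$ for the group of its continuous automorphisms with the topology of uniform convergence (if $G$ is a finitely generated group, then $\mathrm{Aut}\,\widehat G$ is a profinite group). The natural homomorphism $\widehat{\mathrm{Aut}\,F_2}\to\mathrm{Aut}\,\widehat{F_2}$, i.e. the unique continuous homomorphism that extends the homomorphism $\mathrm{Aut}\,F_2\to\mathrm{Aut}\,\widehat{F_2}$ given by functoriality of the profinite completion, is injective. Hence $\Gamma=\mathrm{Aut}\,F_2$ has the congruence subgroup property: for every subgroup $H\le\Gamma$ of finite index there is a normal subgroup $K$ of finite index in $F_2$ such that $$\Gamma[K]=\{\sigma\in\Gamma : \sigma(K)=K \text{ and } \sigma \text{ acts trivially on } F_2/K\}\subseteq H .$$ -/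

import Mathlib

/-! ### Congruence subgroups of automorphism groups -/

/-- For a normal subgroup `K` of `G`, the congruence subgroup `Γ[K]` of `Γ = Aut G`: all
automorphisms `σ` with `σ(K) = K` that act trivially on `G ⧸ K`. -/
def congruenceSubgroup {G : Type*} [Group G] (K : Subgroup G) [K.Normal] :
    Subgroup (MulAut G) where
  carrier := {σ | K.map σ.toMonoidHom = K ∧ ∀ g : G, ((σ g : G) : G ⧸ K) = (g : G ⧸ K)}
  one_mem' := ⟨by
    ext x
    simp [Subgroup.mem_map], fun _ => rfl⟩
  mul_mem' := by
    rintro σ τ ⟨hσ, hσ'⟩ ⟨hτ, hτ'⟩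
    refine ⟨?_, fun g => (hσ' (τ g)).trans (hτ' g)⟩
    have h : (σ * τ).toMonoidHom = σ.toMonoidHom.comp τ.toMonoidHom := rfl
    rw [h, ← Subgroup.map_map, hτ, hσ]
  inv_mem' := by
    rintro σ ⟨hσ, hσ'⟩
    refine ⟨?_, fun g => ?_⟩
    · have h : (σ⁻¹).toMonoidHom.comp σ.toMonoidHom = MonoidHom.id G := by
        ext x
        exact σ.symm_apply_apply x
      conv_lhs => rw [← hσ]
      rw [Subgroup.map_map, h, Subgroup.map_id]
    · have h := hσ' (σ⁻¹ g)
      rw [← h]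
      congr 1
      exact σ.apply_symm_apply g

/-! ### The group of continuous automorphisms of a topological group -/

namespace ContinuousAut

/-- Composition of continuous automorphisms: `(f * g) x = f (g x)`. -/
instance instGroup (P : Type*) [Group P] [TopologicalSpace P] : Group (P ≃ₜ* P) where
  mul f g := g.trans f
  one := ContinuousMulEquiv.refl P
  inv f := f.symm
  mul_assoc _ _ _ := rfl
  one_mul _ := rfl
  mul_one _ := rfl
  inv_mul_cancel f := ContinuousMulEquiv.ext f.symm_apply_apply

/-- The topology of uniform convergence (compact-open topology) on `Aut P`. -/
instance instTopologicalSpace (P : Type*) [Group P] [TopologicalSpace P] :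
    TopologicalSpace (P ≃ₜ* P) :=
  .induced (fun f => (⟨f, f.continuous_toFun⟩ : C(P, P))) inferInstance

variable {P : Type*} [Group P] [TopologicalSpace P]

theorem mul_apply (f g : P ≃ₜ* P) (x : P) : (f * g) x = f (g x) := rfl

theorem inv_eq_symm (f : P ≃ₜ* P) : f⁻¹ = f.symm := rfl

theorem isInducing : Topology.IsInducing (fun f : P ≃ₜ* P => (⟨f, f.continuous_toFun⟩ : C(P, P))) :=
  ⟨rfl⟩

theorem continuous_eval [LocallyCompactSpace P] :
    Continuous (fun q : (P ≃ₜ* P) × P => q.1 q.2) :=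
  (ContinuousEval.continuous_eval (F := C(P, P)) (X := P) (Y := P)).comp
    ((isInducing (P := P)).continuous.prodMap continuous_id)

theorem continuous_symm_eval [CompactSpace P] [T2Space P] :
    Continuous (fun q : (P ≃ₜ* P) × P => q.1.symm q.2) := by
  rw [continuous_iff_isClosed]
  intro C hC
  have h1 : IsClosed {r : ((P ≃ₜ* P) × P) × P | r.1.1 r.2 = r.1.2 ∧ r.2 ∈ C} := by
    refine IsClosed.inter (isClosed_eq ?_ (by fun_prop)) (hC.preimage continuous_snd)
    exact continuous_eval.comp
      ((continuous_fst.comp continuous_fst).prodMk continuous_snd)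
  have h2 := isClosedMap_fst_of_compactSpace (X := (P ≃ₜ* P) × P) (Y := P) _ h1
  convert h2 using 1
  ext ⟨f, x⟩
  constructor
  · intro h
    exact ⟨((f, x), f.symm x), ⟨f.apply_symm_apply x, h⟩, rfl⟩
  · rintro ⟨⟨⟨f', x'⟩, y⟩, ⟨h, hy⟩, h'⟩
    obtain ⟨rfl, rfl⟩ := Prod.mk.inj h'
    dsimp only at h hy
    subst h
    simpa using hy

instance instIsTopologicalGroup [CompactSpace P] [T2Space P] : IsTopologicalGroup (P ≃ₜ* P) where
  continuous_mul := by
    rw [isInducing.continuous_iff]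
    exact ContinuousMap.continuous_of_continuous_uncurry _
      (continuous_eval.comp ((continuous_fst.comp continuous_fst).prodMk
        (continuous_eval.comp ((continuous_snd.comp continuous_fst).prodMk continuous_snd))))
  continuous_inv := by
    rw [isInducing.continuous_iff]
    exact ContinuousMap.continuous_of_continuous_uncurry _ continuous_symm_eval

instance instTotallyDisconnectedSpace [LocallyCompactSpace P] [TotallyDisconnectedSpace P] :
    TotallyDisconnectedSpace (P ≃ₜ* P) := by
  refine ⟨?_⟩
  have hc : Continuous (fun (f : P ≃ₜ* P) (x : P) => f x) :=
    continuous_pi fun x => continuous_eval.comp (continuous_id.prodMk continuous_const)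
  exact isTotallyDisconnected_of_image hc.continuousOn DFunLike.coe_injective
    (isTotallyDisconnected_of_totallyDisconnectedSpace _)

/-- A profinite group with finitely many continuous homomorphisms to each of its finite quotients
has a compact space of continuous endomorphisms. -/
theorem compactSpace_end [IsTopologicalGroup P] [CompactSpace P] [TotallyDisconnectedSpace P]
    (hfin : ∀ N : OpenNormalSubgroup P, Finite (P →ₜ* P ⧸ N.toSubgroup)) :
    CompactSpace (P →ₜ* P) := by
  let _ : UniformSpace P := IsTopologicalGroup.rightUniformSpace P
  have : IsUniformGroup P := IsUniformGroup.of_compactSpace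
  let U : OpenNormalSubgroup P → Set P := fun N => ⋂ h : P →ₜ* P ⧸ N.toSubgroup, {x | h x = 1}
  have hU : ∀ N, U N ∈ nhds (1 : P) := by
    intro N
    have := hfin N
    have : DiscreteTopology (P ⧸ N.toSubgroup) := QuotientGroup.discreteTopology N.isOpen
    refine IsOpen.mem_nhds (isOpen_iInter_of_finite fun h => ?_) (by simp [U])
    exact (isOpen_discrete {(1 : P ⧸ N.toSubgroup)}).preimage h.continuous_toFun
  let A : Set (P → P) := Set.range ((↑) : (P →* P) → P → P) ∩
    ⋂ N : OpenNormalSubgroup P, ⋂ x ∈ U N, {f | f x ∈ N}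
  have hA : IsClosed A := by
    refine (MonoidHom.isClosed_range_coe P P).inter (isClosed_iInter fun N =>
      isClosed_biInter fun x _ => ?_)
    exact (N.toOpenSubgroup.isClosed).preimage (continuous_apply x)
  have hA2 : Equicontinuous ((↑) : A → P → P) := by
    choose φ hφ using fun a : A => a.2.1
    have := equicontinuous_of_equicontinuousAt_one (fun a : A => φ a) (by
      intro V hV
      have hV' : {y : P | ((1 : P), y) ∈ V} ∈ nhds (1 : P) := UniformSpace.ball_mem_nhds _ hV
      obtain ⟨W, hWV, hW, h1W⟩ := mem_nhds_iff.1 hV'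
      obtain ⟨N, hN⟩ := ProfiniteGrp.exist_openNormalSubgroup_sub_open_nhds_of_one hW h1W
      filter_upwards [hU N] with x hx a
      have h := Set.mem_iInter₂.1 (Set.mem_iInter.1 a.2.2 N) x hx
      simp only [Function.comp_apply, map_one]
      rw [hφ a]
      exact hWV (hN h))
    convert this using 1
    ext a : 1
    exact (hφ a).symm
  have himg : ContinuousMap.toFun '' (Set.range
      (ContinuousMonoidHom.toContinuousMap : (P →ₜ* P) → C(P, P))) = A := by
    ext f
    constructor
    · rintro ⟨-, ⟨g, rfl⟩, rfl⟩
      refine ⟨⟨g.toMonoidHom, rfl⟩, Set.mem_iInter.2 fun N => Set.mem_iInter₂.2 fun x hx => ?_⟩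
      have := Set.mem_iInter.1 hx
        ((⟨QuotientGroup.mk' N.toSubgroup, QuotientGroup.continuous_mk⟩ :
          P →ₜ* P ⧸ N.toSubgroup).comp g)
      exact (QuotientGroup.eq_one_iff (N := N.toSubgroup) (g x)).1 this
    · intro hf
      obtain ⟨g, hg⟩ := hf.1
      have hc : Continuous g := by
        rw [hg]
        exact hA2.continuous ⟨f, hf⟩
      exact ⟨_, ⟨⟨g, hc⟩, rfl⟩, hg⟩
  rw [← isCompact_univ_iff, (ContinuousMonoidHom.isInducing_toContinuousMap P P).isCompact_iff,
    Set.image_univ]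
  refine ArzelaAscoli.isCompact_of_equicontinuous _ (himg ▸ hA.isCompact) ?_
  have h := hA2.comp (fun s : Set.range
      (ContinuousMonoidHom.toContinuousMap : (P →ₜ* P) → C(P, P)) =>
    (⟨s.1, himg ▸ Set.mem_image_of_mem _ s.2⟩ : A))
  exact h

theorem compactSpace [IsTopologicalGroup P] [CompactSpace P] [TotallyDisconnectedSpace P]
    (hfin : ∀ N : OpenNormalSubgroup P, Finite (P →ₜ* P ⧸ N.toSubgroup)) :
    CompactSpace (P ≃ₜ* P) := by
  have := compactSpace_end hfin
  let B : Set ((P →ₜ* P) × (P →ₜ* P)) :=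
    (⋂ x, {q | q.1 (q.2 x) = x}) ∩ ⋂ x, {q | q.2 (q.1 x) = x}
  have hB : IsClosed B := by
    have hev : Continuous (fun q : (P →ₜ* P) × P => q.1 q.2) := ContinuousEval.continuous_eval
    refine IsClosed.inter (isClosed_iInter fun x => isClosed_eq ?_ continuous_const)
      (isClosed_iInter fun x => isClosed_eq ?_ continuous_const)
    · exact hev.comp (continuous_fst.prodMk (hev.comp (continuous_snd.prodMk continuous_const)))
    · exact hev.comp (continuous_snd.prodMk (hev.comp (continuous_fst.prodMk continuous_const)))
  have : CompactSpace B := isCompact_iff_compactSpace.1 hB.isCompact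
  let e : B → (P ≃ₜ* P) := fun b =>
    { toFun := b.1.1
      invFun := b.1.2
      left_inv := Set.mem_iInter.1 b.2.2
      right_inv := Set.mem_iInter.1 b.2.1
      map_mul' := map_mul b.1.1
      continuous_toFun := b.1.1.continuous_toFun
      continuous_invFun := b.1.2.continuous_toFun }
  have he : Continuous e := by
    rw [isInducing.continuous_iff]
    exact (ContinuousMonoidHom.isInducing_toContinuousMap P P).continuous.comp
      (continuous_fst.comp continuous_subtype_val)
  have hs : Function.Surjective e := by
    intro f
    refine ⟨⟨((⟨f.toMulEquiv.toMonoidHom, f.continuous_toFun⟩ : P →ₜ* P),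
      (⟨f.symm.toMulEquiv.toMonoidHom, f.symm.continuous_toFun⟩ : P →ₜ* P)),
      Set.mem_iInter.2 f.apply_symm_apply, Set.mem_iInter.2 f.symm_apply_apply⟩, ?_⟩
    ext x
    rfl
  exact hs.compactSpace he

end ContinuousAut

/-! ### The natural homomorphism from the profinite completion of `Aut G` to `Aut Ĝ` -/

universe u

/-- The profinite completion `Ĝ` of an abstract group `G`. -/
noncomputable abbrev profiniteHat (G : Type u) [Group G] : ProfiniteGrp.{u} :=
  ProfiniteGrp.ProfiniteCompletion.completion (GrpCat.of G)

/-- The canonical homomorphism `G → Ĝ`. -/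
def toProfiniteHat (G : Type u) [Group G] : G →* profiniteHat G :=
  (ProfiniteGrp.ProfiniteCompletion.eta (GrpCat.of G)).hom

theorem toProfiniteHat_denseRange (G : Type u) [Group G] : DenseRange (toProfiniteHat G) :=
  ProfiniteGrp.ProfiniteCompletion.denseRange (GrpCat.of G)

/-- The continuous homomorphism `Ĝ → P` that extends a homomorphism `G → P` to a profinite
group `P`. -/
noncomputable def profiniteHatLift {G : Type u} [Group G] {P : ProfiniteGrp.{u}} (f : G →* P) :
    profiniteHat G →ₜ* P :=
  (ProfiniteGrp.ProfiniteCompletion.lift (G := GrpCat.of G) (P := P) (GrpCat.ofHom f)).hom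

theorem profiniteHatLift_apply {G : Type u} [Group G] {P : ProfiniteGrp.{u}} (f : G →* P) (g : G) :
    profiniteHatLift f (toProfiniteHat G g) = f g :=
  CategoryTheory.ConcreteCategory.congr_hom
    (ProfiniteGrp.ProfiniteCompletion.lift_eta (G := GrpCat.of G) (P := P) (GrpCat.ofHom f)) g

theorem profiniteHat_hom_ext {G : Type u} [Group G] {M : Type*} [TopologicalSpace M] [T2Space M]
    {f₁ f₂ : profiniteHat G → M} (h₁ : Continuous f₁) (h₂ : Continuous f₂)
    (h : ∀ g, f₁ (toProfiniteHat G g) = f₂ (toProfiniteHat G g)) : f₁ = f₂ :=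
  (toProfiniteHat_denseRange G).equalizer h₁ h₂ (funext h)

/-- The endomorphism of `Ĝ` induced by an endomorphism of `G`. -/
noncomputable def profiniteHatMap {G : Type u} [Group G] (f : G →* G) :
    profiniteHat G →ₜ* profiniteHat G :=
  profiniteHatLift ((toProfiniteHat G).comp f)

theorem profiniteHatMap_apply {G : Type u} [Group G] (f : G →* G) (g : G) :
    profiniteHatMap f (toProfiniteHat G g) = toProfiniteHat G (f g) :=
  profiniteHatLift_apply _ g

theorem profiniteHatMap_comp {G : Type u} [Group G] (f h : G →* G) (x : profiniteHat G) :
    profiniteHatMap f (profiniteHatMap h x) = profiniteHatMap (f.comp h) x := by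
  refine congrFun (profiniteHat_hom_ext (f₁ := fun x => profiniteHatMap f (profiniteHatMap h x))
    ((profiniteHatMap f).continuous_toFun.comp (profiniteHatMap h).continuous_toFun)
    (profiniteHatMap (f.comp h)).continuous_toFun fun g => ?_) x
  simp [profiniteHatMap_apply]

theorem profiniteHatMap_id {G : Type u} [Group G] (x : profiniteHat G) :
    profiniteHatMap (MonoidHom.id G) x = x := by
  refine congrFun (profiniteHat_hom_ext (f₂ := id)
    (profiniteHatMap (MonoidHom.id G)).continuous_toFun continuous_id fun g => ?_) x
  simp [profiniteHatMap_apply]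

/-- The natural homomorphism `Aut G → Aut Ĝ`. -/
noncomputable def autToAutHat (G : Type u) [Group G] :
    MulAut G →* (profiniteHat G ≃ₜ* profiniteHat G) where
  toFun σ :=
    { toFun := profiniteHatMap σ.toMonoidHom
      invFun := profiniteHatMap σ.symm.toMonoidHom
      left_inv := fun x => by
        rw [profiniteHatMap_comp]
        convert profiniteHatMap_id x
        ext y
        exact σ.symm_apply_apply y
      right_inv := fun x => by
        rw [profiniteHatMap_comp]
        convert profiniteHatMap_id x
        ext y
        exact σ.apply_symm_apply y
      map_mul' := map_mul _
      continuous_toFun := (profiniteHatMap σ.toMonoidHom).continuous_toFun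
      continuous_invFun := (profiniteHatMap σ.symm.toMonoidHom).continuous_toFun }
  map_one' := ContinuousMulEquiv.ext profiniteHatMap_id
  map_mul' σ τ := ContinuousMulEquiv.ext fun x =>
    (profiniteHatMap_comp σ.toMonoidHom τ.toMonoidHom x).symm

theorem autToAutHat_apply (G : Type u) [Group G] (σ : MulAut G) (g : G) :
    autToAutHat G σ (toProfiniteHat G g) = toProfiniteHat G (σ g) :=
  profiniteHatMap_apply _ g

instance compactSpace_autHat (G : Type u) [Group G] [Group.FG G] :
    CompactSpace (profiniteHat G ≃ₜ* profiniteHat G) := by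
  refine ContinuousAut.compactSpace fun N => ?_
  have : DiscreteTopology (profiniteHat G ⧸ N.toSubgroup) :=
    QuotientGroup.discreteTopology N.isOpen
  have : Finite (profiniteHat G ⧸ N.toSubgroup) :=
    Subgroup.quotient_finite_of_isOpen N.toSubgroup N.isOpen
  obtain ⟨S, hS⟩ := Group.fg_def.1 ‹Group.FG G›
  refine Finite.of_injective
    (fun (f : profiniteHat G →ₜ* profiniteHat G ⧸ N.toSubgroup) (s : S) =>
      f (toProfiniteHat G s)) fun f₁ f₂ h => ?_
  have h' : f₁.toMonoidHom.comp (toProfiniteHat G) = f₂.toMonoidHom.comp (toProfiniteHat G) :=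
    MonoidHom.eq_of_eqOn_dense hS fun s hs => congrFun h ⟨s, hs⟩
  exact DFunLike.coe_injective (profiniteHat_hom_ext f₁.continuous_toFun f₂.continuous_toFun
    fun g => DFunLike.congr_fun h' g)

/-- For a finitely generated group `G`, the group `Aut Ĝ` as a profinite group. -/
noncomputable def autHat (G : Type u) [Group G] [Group.FG G] : ProfiniteGrp.{u} :=
  ProfiniteGrp.of (profiniteHat G ≃ₜ* profiniteHat G)

/-- For a finitely generated group `G`, the natural homomorphism from the profinite completion of
`Aut G` to `Aut Ĝ`: the continuous homomorphism extending `Aut G → Aut Ĝ`, obtained from the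
universal property of the profinite completion. -/
noncomputable def hatAutToAutHat (G : Type u) [Group G] [Group.FG G] :
    profiniteHat (MulAut G) →ₜ* (profiniteHat G ≃ₜ* profiniteHat G) :=
  profiniteHatLift (P := autHat G) (autToAutHat G)

theorem hatAutToAutHat_apply (G : Type u) [Group G] [Group.FG G] (σ : MulAut G) :
    hatAutToAutHat G (toProfiniteHat (MulAut G) σ) = autToAutHat G σ :=
  profiniteHatLift_apply (P := autHat G) (autToAutHat G) σ

/-!
The congruence subgroup property of `Aut F₂` is deduced from the fact that a group which is large in
`Aut F₂` is a pure mapping class group of a sphere with five punctures, and so is an extension of a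
free group by a free group in two ways.

The group `PureFive` is a semidirect product of the free group on `d`, `e₁`, `e₂` by the free group
on `s`, `t`; the kernel of its projection is the group of loops of one puncture. The group `fibre` of
loops of a second puncture is another normal subgroup, which contains `d` and `s`. The homomorphism
`toAut : PureFive → Aut F₂` has the following properties.
* It is injective on `fibre` (`toAut_injOn_fibre`). The image of `fibre` lies in the group generated
  by the inner automorphisms and the hyperelliptic involution, which is a free product of three
  groups of order two, and contains the inner automorphisms of a subgroup of finite index of `F₂`
  (`finiteIndex_innerFibre`).
* Its range contains a congruence subgroup (`exists_congruence_le_range`). Nielsen's method gives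
  generators of `Aut F₂` (`eq_top_of_nielsen`), from which it follows that an automorphism that is
  trivial on the abelianisation modulo four has the form `conj f * φ` with `φ` in the group `Phi`
  generated by `alpha : y ↦ x² y` and `beta : x ↦ x y⁻²`. As `φ` fixes the commutator of `x` and
  `y⁻¹`, acting trivially on a suitable finite quotient forces `f` to lie in the subgroup of
  finite index mentioned above.

The other ingredient is that centralisers in finite quotients of free groups are small: for basis
elements `x ≠ z`, whatever commutes with `z²` and `x z² x⁻¹` in a large finite quotient is trivial in
a given finite quotient (`exists_characteristic_centralizer_le`). The large quotients are iterated
wreath products. Applied in both factors of the semidirect product, this shows that an element `g` of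
`PureFive` lies in a given normal subgroup of finite index as soon as its commutators with `d²`,
`s²` and one conjugate of each lie in a suitable subgroup `L` of finite index
(`exists_finiteIndex_centralizer_le`). These four elements lie in `fibre` and act on `F₂` by inner
automorphisms `conj f`, so that the commutator with `g` acts by `conj (σ f * f⁻¹)`, where
`σ = toAut g`. If `σ` acts trivially on a suitable finite quotient of `F₂`, then
`conj (σ f * f⁻¹)` comes from an element of `fibre ⊓ L`, and injectivity on `fibre` puts the
commutator into `L`.

Finally, injectivity of the map on the profinite completion follows by approximation
(`hatAutToAutHat_injective`): an element of the kernel is close to an automorphism `σ` that acts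
trivially on a given finite quotient of `F₂`, and hence lies in any given subgroup of finite index.
-/

open scoped commutatorElement

/-! ### Centralisers in finite quotients of free groups -/

namespace RegularWreathProduct

variable {D Q : Type*} [CommGroup D] [Group Q]

open Classical in
/-- The element of the wreath product lying over `q` whose base component is supported at `1`. -/
noncomputable def single (d : D) (q : Q) : D ≀ᵣ Q := ⟨Pi.mulSingle 1 d, q⟩

theorem right_pow (a : D ≀ᵣ Q) (n : ℕ) : (a ^ n).right = a.right ^ n :=
  map_pow rightHom a n

open Classical in
theorem left_single_pow (d : D) (q : Q) (n : ℕ) (x : Q) :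
    (single d q ^ n).left x = ∏ l ∈ Finset.range n, (Pi.mulSingle 1 d : Q → D) ((q ^ l)⁻¹ * x) := by
  induction n with
  | zero => simp
  | succ n ih =>
    rw [pow_succ, mul_left, Pi.mul_apply, ih, Finset.prod_range_succ, right_pow]
    rfl

/-- For an element `single d q` with `d ^ 2 ≠ 1`, everything that commutes with its square lies over
a power of `q`: the `orderOf q`-th power of `single d q` is a function whose support is the cyclic
group generated by `q`, and elements that commute with the square of this function preserve its
support. -/
theorem right_mem_zpowers_of_commute [Finite Q] {d : D} (hd : d ^ 2 ≠ 1) {q : Q} {b : D ≀ᵣ Q}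
    (h : Commute b (single d q ^ 2)) : b.right ∈ Subgroup.zpowers q := by
  classical
  set m := orderOf q with hm
  have hmpos : 0 < m := orderOf_pos q
  have h1 : (single d q ^ m).left 1 = d := by
    rw [left_single_pow, Finset.prod_eq_single 0]
    · simp
    · intro l hl hl0
      rw [Pi.mulSingle_eq_of_ne]
      rw [mul_one, Ne, inv_eq_one]
      exact pow_ne_one_of_lt_orderOf hl0 (Finset.mem_range.1 hl)
    · intro h0
      exact absurd (Finset.mem_range.2 hmpos) h0
  have h2 : ∀ x, (single d q ^ m).left x ≠ 1 → x ∈ Subgroup.zpowers q := by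
    intro x hx
    rw [left_single_pow] at hx
    obtain ⟨l, -, hl⟩ := Finset.exists_ne_one_of_prod_ne_one hx
    have : (q ^ l)⁻¹ * x = 1 := by
      by_contra hne
      exact hl (Pi.mulSingle_eq_of_ne hne _)
    rw [inv_mul_eq_one] at this
    exact ⟨l, by simpa using this⟩
  have hr : (single d q ^ m).right = 1 := by
    rw [right_pow]
    exact pow_orderOf_eq_one q
  have hc : Commute b ((single d q ^ m) ^ 2) := by
    rw [← pow_mul, mul_comm, pow_mul]
    exact h.pow_right m
  have hc' := congrFun (congrArg RegularWreathProduct.left hc.eq) b.right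
  have hr2 : ((single d q ^ m) ^ 2).right = 1 := by rw [right_pow, hr, one_pow]
  have hl2 : ∀ x, ((single d q ^ m) ^ 2).left x = ((single d q ^ m).left x) ^ 2 := by
    intro x
    rw [sq, mul_left, Pi.mul_apply, hr, inv_one, one_mul, sq]
  rw [mul_left, mul_left, Pi.mul_apply, Pi.mul_apply, hr2, inv_one, one_mul, inv_mul_cancel, hl2,
    hl2, h1, mul_comm] at hc'
  have h3 : (single d q ^ m).left b.right ^ 2 = d ^ 2 := (mul_right_cancel hc').symm
  refine h2 _ fun h4 => hd ?_
  rw [← h3, h4, one_pow]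

/-- If a conjugate of an element `q` of the complement by `single d p` lies in the complement, then
`q = 1`: comparing base components, multiplication by `q` preserves the support `{1}` of that of
`single d p`. -/
theorem right_eq_one_of_mul_single {d : D} (hd : d ≠ 1) {p q r : Q}
    (h : inl q * single d p = single d p * inl r) : q = 1 := by
  classical
  have h1 := congrFun (congrArg RegularWreathProduct.left h) q
  by_contra hq
  simp only [mul_left, left_inl, right_inl, Pi.mul_apply, Pi.one_apply, one_mul, mul_one, single,
    inv_mul_cancel, Pi.mulSingle_eq_same] at h1
  rw [Pi.mulSingle_eq_of_ne hq] at h1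
  exact hd h1

end RegularWreathProduct

/-- The intersection of the kernels of all homomorphisms `G → P`. -/
def homKernel (G P : Type*) [Group G] [Group P] : Subgroup G := ⨅ h : G →* P, h.ker

theorem mem_homKernel {G P : Type*} [Group G] [Group P] {g : G} :
    g ∈ homKernel G P ↔ ∀ h : G →* P, h g = 1 := by
  simp [homKernel, Subgroup.mem_iInf, MonoidHom.mem_ker]

instance homKernel_characteristic (G P : Type*) [Group G] [Group P] :
    (homKernel G P).Characteristic := by
  rw [Subgroup.characteristic_iff_le_comap]
  intro σ g hg
  rw [Subgroup.mem_comap, mem_homKernel]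
  intro h
  exact mem_homKernel.1 hg (h.comp σ.toMonoidHom)

instance homKernel_finiteIndex (X P : Type*) [Finite X] [Group P] [Finite P] :
    (homKernel (FreeGroup X) P).FiniteIndex := by
  have : Finite (FreeGroup X →* P) := Finite.of_equiv _ (FreeGroup.lift (α := X) (β := P))
  exact Subgroup.finiteIndex_iInf fun h => Subgroup.finiteIndex_ker h

open FreeGroup (of) in
/-- The square of a basis element of a free group and the square of a conjugate of it by another
basis element have trivial common centraliser, in the following residual form: for every `M` of
finite index there is an `N` of finite index such that everything that commutes with the two
elements modulo `N` lies in `M`. -/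
theorem exists_characteristic_centralizer_le {X : Type*} [Finite X] {x z : X}
    (hxz : x ≠ z) (M : Subgroup (FreeGroup X)) [M.Normal] [M.FiniteIndex] :
    ∃ N : Subgroup (FreeGroup X), N.Characteristic ∧ N.FiniteIndex ∧ ∀ w : FreeGroup X,
      ⁅w, of z ^ 2⁆ ∈ N → ⁅w, of x * of z ^ 2 * (of x)⁻¹⁆ ∈ N → w ∈ M := by
  classical
  let D := Multiplicative (ZMod 3)
  let d : D := Multiplicative.ofAdd 1
  have hd : d ≠ 1 := by decide
  have hd2 : d ^ 2 ≠ 1 := by decide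
  let P := FreeGroup X ⧸ M
  let mark (i : X) {R : Type _} [Group R] (f : FreeGroup X →* R) : FreeGroup X →* D ≀ᵣ R :=
    FreeGroup.lift fun j => if j = i then RegularWreathProduct.single d (f (of j))
      else RegularWreathProduct.inl (f (of j))
  have hmark : ∀ (i : X) {R : Type _} [Group R] (f : FreeGroup X →* R) (w : FreeGroup X),
      (mark i f w).right = f w := by
    intro i R _ f w
    have : (RegularWreathProduct.rightHom).comp (mark i f) = f := by
      ext j
      simp only [mark, MonoidHom.comp_apply, FreeGroup.lift_apply_of]
      split_ifs <;> rfl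
    exact DFunLike.congr_fun this w
  let f₀ : FreeGroup X →* P := QuotientGroup.mk' M
  -- Marking `x` first makes the cyclic group generated by `z` meet its conjugate by `x` only in
  -- elements that are trivial in `P`; marking `z` then makes centralisers cyclic.
  let f₁ := mark x f₀
  let f₂ := mark z f₁
  refine ⟨homKernel (FreeGroup X) (D ≀ᵣ (D ≀ᵣ P)), inferInstance, inferInstance, fun w h1 h2 => ?_⟩
  have hz : f₂ (of z) = RegularWreathProduct.single d (f₁ (of z)) := by simp [f₂, mark]
  have hx1 : f₁ (of x) = RegularWreathProduct.single d (f₀ (of x)) := by simp [f₁, mark]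
  have hz1 : f₁ (of z) = RegularWreathProduct.inl (f₀ (of z)) := by simp [f₁, mark, hxz.symm]
  have key : ∀ v : FreeGroup X, f₂ ⁅v, of z ^ 2⁆ = 1 → f₁ v ∈ Subgroup.zpowers (f₁ (of z)) := by
    intro v hv
    rw [map_commutatorElement, commutatorElement_eq_one_iff_commute, map_pow, hz] at hv
    have := RegularWreathProduct.right_mem_zpowers_of_commute hd2 hv
    rwa [hmark] at this
  obtain ⟨i, hi⟩ := key w (mem_homKernel.1 h1 f₂)
  obtain ⟨j, hj⟩ := key ((of x)⁻¹ * w * of x) (by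
    have h3 := mem_homKernel.1 h2 f₂
    have h4 : ⁅(of x)⁻¹ * w * of x, of z ^ 2⁆ =
        (of x)⁻¹ * ⁅w, of x * of z ^ 2 * (of x)⁻¹⁆ * of x := by
      simp only [commutatorElement_def]
      group
    rw [h4, map_mul, map_mul, h3, mul_one, ← map_mul, inv_mul_cancel, map_one])
  dsimp only at hi hj
  rw [hz1, ← map_zpow] at hi hj
  rw [map_mul, map_mul, map_inv, ← hi, mul_assoc, eq_inv_mul_iff_mul_eq, hx1] at hj
  have h5 := RegularWreathProduct.right_eq_one_of_mul_single hd hj.symm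
  rw [← QuotientGroup.eq_one_iff, ← h5]
  have h6 := congrArg RegularWreathProduct.right hi
  rw [hmark] at h6
  exact h6.symm

/-! ### Gromov products in free groups -/

/-- The length of the longest common prefix of two lists. -/
def List.commonPrefixLength {α : Type*} [DecidableEq α] : List α → List α → ℕ
  | a :: l, b :: m => if a = b then commonPrefixLength l m + 1 else 0
  | [], _ => 0
  | _ :: _, [] => 0

namespace List

variable {α : Type*} [DecidableEq α]

theorem commonPrefixLength_comm (l m : List α) :
    commonPrefixLength l m = commonPrefixLength m l := by
  induction l generalizing m with
  | nil => cases m <;> rfl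
  | cons a l ih =>
    cases m with
    | nil => rfl
    | cons b m => simp only [commonPrefixLength, ih m, eq_comm (a := a)]

theorem min_commonPrefixLength_le (l m n : List α) :
    min (commonPrefixLength l m) (commonPrefixLength m n) ≤ commonPrefixLength l n := by
  induction m generalizing l n with
  | nil => cases l <;> simp [commonPrefixLength]
  | cons b m ih =>
    cases l with
    | nil => simp [commonPrefixLength]
    | cons a l =>
      cases n with
      | nil => simp [commonPrefixLength]
      | cons c n =>
        have := ih l n
        simp only [commonPrefixLength]
        split_ifs with h1 h2 h3 h3 h2 <;> first | omega | simp_all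

end List

namespace FreeGroup

theorem mk_cons {α : Type*} (l : α × Bool) (L : List (α × Bool)) :
    mk (l :: L) = mk [l] * mk L := rfl

variable {α : Type*} [DecidableEq α]

theorem IsReduced.invRev {L : List (α × Bool)} (h : IsReduced L) :
    IsReduced (FreeGroup.invRev L) := by
  rw [isReduced_iff_reduce_eq, reduce_invRev, h.reduce_eq]

theorem IsReduced.norm_mk {L : List (α × Bool)} (h : IsReduced L) : norm (mk L) = L.length := by
  rw [norm, toWord_mk, h.reduce_eq]

theorem norm_inv_mk_mul_mk {L M : List (α × Bool)} (hL : IsReduced L) (hM : IsReduced M) :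
    norm ((mk L)⁻¹ * mk M) + 2 * List.commonPrefixLength L M = L.length + M.length := by
  induction L generalizing M with
  | nil =>
    have h1 : (mk ([] : List (α × Bool)))⁻¹ * mk M = mk M := by rw [← one_eq_mk, inv_one, one_mul]
    rw [h1, hM.norm_mk]
    cases M <;> simp [List.commonPrefixLength]
  | cons l L ih =>
    cases M with
    | nil =>
      have h1 : (mk (l :: L))⁻¹ * mk [] = (mk (l :: L))⁻¹ := by rw [← one_eq_mk, mul_one]
      rw [h1, norm_inv_eq, hL.norm_mk]
      simp [List.commonPrefixLength]
    | cons m M =>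
      simp only [List.commonPrefixLength]
      split_ifs with h
      · subst h
        have h1 : (mk (l :: L))⁻¹ * mk (l :: M) = (mk L)⁻¹ * mk M := by
          rw [mk_cons l L, mk_cons l M]
          group
        have := ih (List.IsChain.of_cons hL) (List.IsChain.of_cons hM)
        rw [h1]
        simp only [List.length_cons]
        omega
      · have h1 : (mk (l :: L))⁻¹ * mk (m :: M) = mk (FreeGroup.invRev (l :: L) ++ (m :: M)) := by
          rw [inv_mk, mul_mk]
        have h2 : IsReduced (FreeGroup.invRev (l :: L) ++ (m :: M)) := by
          refine List.isChain_append.2 ⟨hL.invRev, hM, ?_⟩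
          intro p hp q hq
          simp only [FreeGroup.invRev, List.map_cons, List.reverse_cons, List.getLast?_append,
            List.getLast?_singleton, Option.some_or, Option.mem_def, Option.some.injEq,
            List.head?_cons] at hp hq
          subst hp hq
          intro h3
          by_contra h4
          refine h (Prod.ext h3 ?_)
          revert h4
          dsimp only
          cases l.2 <;> cases m.2 <;> simp
        rw [h1, h2.norm_mk]
        simp

/-- The Gromov product of `g` and `h` with respect to `1` in the Cayley tree of a free group: the
length of the longest common prefix of the reduced words of `g` and `h`. -/
def gromov (g h : FreeGroup α) : ℕ := List.commonPrefixLength g.toWord h.toWord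

theorem gromov_comm (g h : FreeGroup α) : gromov g h = gromov h g :=
  List.commonPrefixLength_comm _ _

theorem min_gromov_le (g h k : FreeGroup α) : min (gromov g h) (gromov h k) ≤ gromov g k :=
  List.min_commonPrefixLength_le _ _ _

theorem norm_inv_mul (g h : FreeGroup α) : norm (g⁻¹ * h) + 2 * gromov g h = norm g + norm h := by
  have := norm_inv_mk_mul_mk (isReduced_toWord (x := g)) (isReduced_toWord (x := h))
  rwa [mk_toWord, mk_toWord] at this

theorem norm_mul (g h : FreeGroup α) : norm (g * h) + 2 * gromov g⁻¹ h = norm g + norm h := by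
  have := norm_inv_mul g⁻¹ h
  rwa [inv_inv, norm_inv_eq] at this

/-- If the reduced words of `g` and `g⁻¹` start with the same letter `e`, then conjugation by `e`
shortens `g`. -/
theorem norm_conj_lt {e g : FreeGroup α} (he : norm e = 1) (h1 : 0 < gromov e g)
    (h2 : 0 < gromov e g⁻¹) : norm (e⁻¹ * g * e) < norm g := by
  have a1 := norm_inv_mul e g
  have a2 := norm_mul (e⁻¹ * g) e
  have a3 := norm_inv_mul g (g * e)
  have a4 := norm_mul g e
  have a5 := norm_inv_mul e (g * e)
  have a6 := min_gromov_le e g (g * e)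
  have e1 : e⁻¹ * (g * e) = e⁻¹ * g * e := by group
  have e2 : g⁻¹ * (g * e) = e := by group
  have e3 := gromov_comm e g⁻¹
  rw [e1] at a5
  rw [e2] at a3
  by_cases h3 : norm g ≤ 1
  · -- A word of length one cannot start with the same letter as its inverse.
    have h4 : e⁻¹ * g = 1 := by
      rw [← norm_eq_zero]
      omega
    have h5 : g = e := by rwa [inv_mul_eq_one, eq_comm] at h4
    subst h5
    have h6 : norm (g * g) = 0 := by omega
    rw [norm_eq_zero, ← sq, pow_eq_one_iff_left two_ne_zero] at h6
    rw [h6] at he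
    simp at he
  · omega

theorem norm_conj_le {e g : FreeGroup α} (he : norm e = 1) (h1 : 0 < gromov e g) :
    norm (e⁻¹ * g * e) ≤ norm g := by
  have a1 := norm_inv_mul e g
  have a2 := norm_mul_le (e⁻¹ * g) e
  omega

theorem norm_lt_norm_mul_self {g : FreeGroup α} (hg : g ≠ 1) : norm g < norm (g * g) := by
  have h1 := reduceCyclically.reduce_flatten_replicate_succ (isReduced_toWord (x := g)) 1
  have h2 : (g * g).toWord = reduce (List.replicate (1 + 1) g.toWord).flatten := by
    rw [toWord_mul]
    simp [List.replicate]
  have h3 := congrArg List.length (reduceCyclically.conj_conjugator_reduceCyclically g.toWord)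
  have h4 : 0 < g.toWord.length := List.length_pos_iff.2 (mt toWord_eq_nil_iff.1 hg)
  have h5 : 0 < (reduceCyclically g.toWord).length := by
    rw [List.length_pos_iff]
    intro h6
    have h7 := reduceCyclically.conj_conjugator_reduceCyclically g.toWord
    rw [h6, List.append_nil] at h7
    have h8 := congrArg mk h7
    rw [← mul_mk, ← inv_mk, mul_inv_cancel, mk_toWord] at h8
    exact hg h8.symm
  unfold norm
  rw [h2, h1]
  simp only [List.length_append, invRev_length, List.length_flatten, List.map_replicate,
    List.sum_replicate, smul_eq_mul] at h3 ⊢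
  omega

theorem two_mul_gromov_inv_lt {g : FreeGroup α} (hg : g ≠ 1) : 2 * gromov g⁻¹ g < norm g := by
  have := norm_mul g g
  have := norm_lt_norm_mul_self hg
  omega

/-- Two elements with a positive Gromov product start with the same letter. -/
theorem exists_letter {g : FreeGroup α} (hg : g ≠ 1) :
    ∃ e : FreeGroup α, norm e = 1 ∧ ∀ h, 0 < gromov g h → 0 < gromov e h := by
  obtain ⟨l, L, hL⟩ := List.exists_cons_of_ne_nil (mt toWord_eq_nil_iff.1 hg)
  refine ⟨mk [l], IsReduced.singleton.norm_mk, fun h hh => ?_⟩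
  have h1 : (mk [l]).toWord = [l] := by rw [toWord_mk, IsReduced.singleton.reduce_eq]
  unfold gromov at hh ⊢
  rw [h1]
  rw [hL] at hh
  cases hw : h.toWord with
  | nil => rw [hw] at hh; simp [List.commonPrefixLength] at hh
  | cons m M =>
    rw [hw] at hh
    simp only [List.commonPrefixLength] at hh ⊢
    split_ifs at hh ⊢ with h2
    · omega
    · omega

end FreeGroup

/-! ### Nielsen's method for pairs of elements -/

namespace FreeGroup

variable {α : Type*} [DecidableEq α]

/-- A set of pairs of elements of a free group that is closed under the length-preserving elementary
Nielsen moves, and whose members cannot be shortened by an elementary Nielsen move or by a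
simultaneous conjugation. -/
structure IsNielsenMinimal (S : Set (FreeGroup α × FreeGroup α)) : Prop where
  swap : ∀ {a b}, (a, b) ∈ S → (b, a) ∈ S
  inv : ∀ {a b}, (a, b) ∈ S → (a⁻¹, b) ∈ S
  le_norm_mul : ∀ {a b}, (a, b) ∈ S → norm a ≤ norm (a * b)
  mul : ∀ {a b}, (a, b) ∈ S → norm (a * b) = norm a → (a * b, b) ∈ S
  le_norm_conj : ∀ {a b}, (a, b) ∈ S → ∀ e : FreeGroup α,
    norm a + norm b ≤ norm (e⁻¹ * a * e) + norm (e⁻¹ * b * e)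
  ne_one : ∀ {a b}, (a, b) ∈ S → a ≠ 1

namespace IsNielsenMinimal

variable {S : Set (FreeGroup α × FreeGroup α)} {a b : FreeGroup α}

theorem two_mul_gromov_le_right (hS : IsNielsenMinimal S) (h : (a, b) ∈ S) :
    2 * gromov a b ≤ norm b := by
  have h1 := hS.le_norm_mul (hS.inv h)
  have h2 := norm_inv_mul a b
  rw [norm_inv_eq] at h1
  omega

theorem two_mul_gromov_le_left (hS : IsNielsenMinimal S) (h : (a, b) ∈ S) :
    2 * gromov a b ≤ norm a := by
  rw [gromov_comm]
  exact hS.two_mul_gromov_le_right (hS.swap h)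

theorem inv_right (hS : IsNielsenMinimal S) (h : (a, b) ∈ S) : (a, b⁻¹) ∈ S :=
  hS.swap (hS.inv (hS.swap h))

/-- If both halves of `b` cancelled against `a`, then `b`, `b⁻¹` and `a` would start with the same
letter, and conjugation by this letter would shorten the pair. -/
theorem gromov_add_gromov_lt (hS : IsNielsenMinimal S) (h : (a, b) ∈ S) :
    gromov a b + gromov b⁻¹ a < norm b := by
  by_contra! hle
  have h1 := hS.two_mul_gromov_le_right h
  have h2 := hS.two_mul_gromov_le_right (hS.inv_right h)
  have hb : 0 < norm b := Nat.pos_of_ne_zero (mt norm_eq_zero.1 (hS.ne_one (hS.swap h)))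
  rw [norm_inv_eq, gromov_comm] at h2
  obtain ⟨e, he, hh⟩ := exists_letter (hS.ne_one h)
  have h3 := gromov_comm a b⁻¹
  have h4 : 0 < norm a := Nat.pos_of_ne_zero (mt norm_eq_zero.1 (hS.ne_one h))
  have ha : 0 < gromov a a := by
    have := norm_inv_mul a a
    rw [inv_mul_cancel, norm_one] at this
    omega
  have h5 := norm_conj_lt he (hh b (by omega)) (hh b⁻¹ (by omega))
  have h6 := norm_conj_le he (hh a ha)
  have h7 := hS.le_norm_conj h e
  omega

/-- If the two halves of `b` cancelled against `a` and `a⁻¹`, then `a⁻¹ * b` would be as long as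
`a`, and conjugation by its first letter would shorten the pair `(a⁻¹ * b, b)`. -/
theorem gromov_add_gromov_inv_lt (hS : IsNielsenMinimal S) (h : (a, b) ∈ S) :
    gromov a b + gromov b⁻¹ a⁻¹ < norm b := by
  by_contra! hle
  have h1 := hS.two_mul_gromov_le_right h
  have h2 := hS.two_mul_gromov_le_right (hS.inv_right (hS.inv h))
  have h2' := hS.two_mul_gromov_le_left h
  have hb : 0 < norm b := Nat.pos_of_ne_zero (mt norm_eq_zero.1 (hS.ne_one (hS.swap h)))
  rw [norm_inv_eq, gromov_comm] at h2
  have h3 := norm_inv_mul a b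
  have hg : (a⁻¹ * b, b) ∈ S := hS.mul (hS.inv h) (by rw [norm_inv_eq]; omega)
  obtain ⟨e, he, hh⟩ := exists_letter (hS.ne_one (hS.inv h))
  have c1 : 0 < gromov a⁻¹ (a⁻¹ * b) := by
    have := norm_inv_mul a⁻¹ (a⁻¹ * b)
    rw [inv_inv, mul_inv_cancel_left, norm_inv_eq] at this
    omega
  have c2 : 0 < gromov a⁻¹ b⁻¹ := by
    rw [gromov_comm]
    omega
  have c3 : 0 < gromov b⁻¹ (a⁻¹ * b)⁻¹ := by
    have := norm_inv_mul b⁻¹ (a⁻¹ * b)⁻¹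
    rw [show b⁻¹⁻¹ * (a⁻¹ * b)⁻¹ = a by group, norm_inv_eq, norm_inv_eq] at this
    omega
  have c4 : 0 < gromov a⁻¹ (a⁻¹ * b)⁻¹ :=
    lt_of_lt_of_le (lt_min c2 c3) (min_gromov_le a⁻¹ b⁻¹ (a⁻¹ * b)⁻¹)
  have h5 := norm_conj_lt he (hh _ c1) (hh _ c4)
  have h6 := norm_conj_le he (hh _ c2)
  rw [show e⁻¹ * b⁻¹ * e = (e⁻¹ * b * e)⁻¹ by group, norm_inv_eq, norm_inv_eq] at h6
  have h7 := hS.le_norm_conj hg e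
  omega

end IsNielsenMinimal

variable {S : Set (FreeGroup α × FreeGroup α)}

/-- A homomorphism whose values on the two basis elements form a Nielsen minimal pair: the two
cancellations at a letter of a reduced word never consume the whole letter. -/
theorem gromov_add_gromov_lt_of_isNielsenMinimal (hS : IsNielsenMinimal S)
    {f : FreeGroup (Fin 2) →* FreeGroup α} (hf : (f (of 0), f (of 1)) ∈ S)
    {l₀ l₁ l₂ : Fin 2 × Bool} (h₀ : l₀.1 = l₁.1 → l₀.2 = l₁.2)
    (h₁ : l₁.1 = l₂.1 → l₁.2 = l₂.2) :
    gromov (f (mk [l₀]))⁻¹ (f (mk [l₁])) + gromov (f (mk [l₁]))⁻¹ (f (mk [l₂]))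
      < norm (f (mk [l₁])) := by
  have hinv : ∀ i : Fin 2, f (mk [(i, false)]) = (f (mk [(i, true)]))⁻¹ := by
    intro i
    rw [← _root_.map_inv, inv_mk]
    rfl
  have hmem : ∀ l m : Fin 2 × Bool, l.1 ≠ m.1 → (f (mk [l]), f (mk [m])) ∈ S := by
    rintro ⟨i, p⟩ ⟨j, q⟩ hij
    have h : (f (mk [(i, true)]), f (mk [(j, true)])) ∈ S := by
      fin_cases i <;> fin_cases j
      · exact absurd rfl hij
      · exact hf
      · exact hS.swap hf
      · exact absurd rfl hij
    cases p <;> cases q <;> try simp only [hinv]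
    · exact hS.inv_right (hS.inv h)
    · exact hS.inv h
    · exact hS.inv_right h
    · exact h
  have hne : f (mk [l₁]) ≠ 1 := by
    have : l₁.1 ≠ (1 - l₁.1, true).1 := by
      generalize l₁.1 = i
      fin_cases i <;> decide
    exact hS.ne_one (hmem l₁ (1 - l₁.1, true) this)
  have hself := two_mul_gromov_inv_lt hne
  by_cases e₀ : l₀.1 = l₁.1
  · have e₀' : l₀ = l₁ := Prod.ext e₀ (h₀ e₀)
    subst e₀'
    by_cases e₁ : l₀.1 = l₂.1
    · have e₁' : l₀ = l₂ := Prod.ext e₁ (h₁ e₁)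
      subst e₁'
      omega
    · have := hS.two_mul_gromov_le_left (hS.inv (hmem l₀ l₂ e₁))
      rw [norm_inv_eq] at this
      omega
  · have a1 := hS.inv (hmem l₀ l₁ e₀)
    have a2 := hS.two_mul_gromov_le_right a1
    by_cases e₁ : l₁.1 = l₂.1
    · have e₁' : l₁ = l₂ := Prod.ext e₁ (h₁ e₁)
      subst e₁'
      omega
    · have e₂ : l₂.1 = l₀.1 := by
        revert e₀ e₁
        generalize l₀.1 = i
        generalize l₁.1 = j
        generalize l₂.1 = k
        revert i j k
        decide
      have e₃ : f (mk [l₂]) = (f (mk [l₀]))⁻¹ ∨ f (mk [l₂]) = (f (mk [l₀]))⁻¹⁻¹ := by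
        obtain ⟨i, p⟩ := l₀
        obtain ⟨j, q⟩ := l₂
        dsimp only at e₂
        subst e₂
        cases p <;> cases q <;> simp [hinv]
      rcases e₃ with e₃ | e₃ <;> rw [e₃]
      · exact hS.gromov_add_gromov_lt a1
      · exact hS.gromov_add_gromov_inv_lt a1

/-- Homomorphisms given by Nielsen minimal pairs do not shorten words. -/
theorem norm_le_norm_map_of_isNielsenMinimal (hS : IsNielsenMinimal S)
    {f : FreeGroup (Fin 2) →* FreeGroup α} (hf : (f (of 0), f (of 1)) ∈ S)
    (w : FreeGroup (Fin 2)) : norm w ≤ norm (f w) := by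
  have key : ∀ (L : List (Fin 2 × Bool)) (l₀ l₁ : Fin 2 × Bool), IsReduced (l₀ :: l₁ :: L) →
      gromov (f (mk [l₀]))⁻¹ (f (mk (l₁ :: L))) = gromov (f (mk [l₀]))⁻¹ (f (mk [l₁])) ∧
      (l₁ :: L).length + gromov (f (mk [l₀]))⁻¹ (f (mk [l₁])) ≤ norm (f (mk (l₁ :: L))) := by
    intro L
    induction L with
    | nil =>
      intro l₀ l₁ h
      have := gromov_add_gromov_lt_of_isNielsenMinimal hS hf (isReduced_cons_cons.1 h).1
        (l₂ := l₁) fun _ => rfl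
      refine ⟨rfl, ?_⟩
      simp only [List.length_singleton]
      omega
    | cons l₂ L ih =>
      intro l₀ l₁ h
      obtain ⟨h₀, h⟩ := isReduced_cons_cons.1 h
      obtain ⟨i1, i2⟩ := ih l₁ l₂ h
      have h3 := gromov_add_gromov_lt_of_isNielsenMinimal hS hf h₀ (isReduced_cons_cons.1 h).1
      have h4 : f (mk (l₁ :: l₂ :: L)) = f (mk [l₁]) * f (mk (l₂ :: L)) := by
        rw [mk_cons, _root_.map_mul]
      have h5 := norm_mul (f (mk [l₁])) (f (mk (l₂ :: L)))
      have h6 := norm_inv_mul (f (mk [l₁])) (f (mk (l₁ :: l₂ :: L)))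
      have h7 : (f (mk [l₁]))⁻¹ * f (mk (l₁ :: l₂ :: L)) = f (mk (l₂ :: L)) := by
        rw [h4, inv_mul_cancel_left]
      rw [h7] at h6
      rw [← h4] at h5
      have u1 := min_gromov_le (f (mk [l₀]))⁻¹ (f (mk [l₁])) (f (mk (l₁ :: l₂ :: L)))
      have u2 := min_gromov_le (f (mk [l₀]))⁻¹ (f (mk (l₁ :: l₂ :: L))) (f (mk [l₁]))
      rw [gromov_comm (f (mk (l₁ :: l₂ :: L))) (f (mk [l₁]))] at u2
      simp only [List.length_cons] at i2 ⊢
      constructor <;> omega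
  rw [← mk_toWord (x := w), isReduced_toWord.norm_mk]
  cases hw : w.toWord with
  | nil => simp
  | cons l L =>
    have := (key L l l (isReduced_cons_cons.2 ⟨fun _ => rfl, hw ▸ isReduced_toWord⟩)).2
    omega

end FreeGroup

/-! ### Generators of the automorphism group in rank two -/

namespace FreeGroup

/-- The automorphism of a free group given by the images of the basis elements under it and under
its inverse. -/
def mulAutOfLift {X : Type*} (f g : X → FreeGroup X) (hfg : ∀ i, lift f (g i) = of i)
    (hgf : ∀ i, lift g (f i) = of i) : MulAut (FreeGroup X) :=
  MonoidHom.toMulEquiv (lift f) (lift g) (ext_hom _ _ fun i => by simp [hgf])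
    (ext_hom _ _ fun i => by simp [hfg])

@[simp]
theorem mulAutOfLift_of {X : Type*} (f g : X → FreeGroup X) (hfg hgf) (i : X) :
    mulAutOfLift f g hfg hgf (of i) = f i :=
  lift_apply_of

theorem mulAut_ext {X : Type*} {σ τ : MulAut (FreeGroup X)} (h : ∀ i, σ (of i) = τ (of i)) :
    σ = τ :=
  MulEquiv.toMonoidHom_injective (ext_hom _ _ h)

theorem mulAut_ext_two {σ τ : MulAut (FreeGroup (Fin 2))} (h0 : σ (of 0) = τ (of 0))
    (h1 : σ (of 1) = τ (of 1)) : σ = τ :=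
  mulAut_ext (Fin.forall_fin_two.2 ⟨h0, h1⟩)

/-- The Nielsen move `x ↦ y`, `y ↦ x`. -/
def swapAut : MulAut (FreeGroup (Fin 2)) :=
  mulAutOfLift ![of 1, of 0] ![of 1, of 0] (by simp [Fin.forall_fin_two])
    (by simp [Fin.forall_fin_two])

/-- The Nielsen move `x ↦ x⁻¹`, `y ↦ y`. -/
def invAut : MulAut (FreeGroup (Fin 2)) :=
  mulAutOfLift ![(of 0)⁻¹, of 1] ![(of 0)⁻¹, of 1] (by simp [Fin.forall_fin_two])
    (by simp [Fin.forall_fin_two])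

/-- The Nielsen move `x ↦ x * y`, `y ↦ y`. -/
def mulAutXY : MulAut (FreeGroup (Fin 2)) :=
  mulAutOfLift ![of 0 * of 1, of 1] ![of 0 * (of 1)⁻¹, of 1] (by simp [Fin.forall_fin_two])
    (by simp [Fin.forall_fin_two])

section

variable {Δ : Subgroup (MulAut (FreeGroup (Fin 2)))}

/-- An automorphism that maps both basis elements to letters is a product of `swapAut` and `invAut`.
-/
theorem mem_of_permutes_letters (hswap : swapAut ∈ Δ) (hinv : invAut ∈ Δ)
    {τ : MulAut (FreeGroup (Fin 2))} {l m : Fin 2 × Bool} (h0 : τ (of 0) = mk [l])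
    (h1 : τ (of 1) = mk [m]) : τ ∈ Δ := by
  have hlm : l.1 ≠ m.1 := by
    intro h
    have h2 : τ (of 0) = τ (of 1) ∨ τ (of 0) = (τ (of 1))⁻¹ := by
      obtain ⟨i, p⟩ := l
      obtain ⟨j, q⟩ := m
      dsimp only at h
      subst h
      rw [h0, h1]
      cases p <;> cases q <;> simp [invRev]
    rw [← _root_.map_inv, τ.injective.eq_iff, τ.injective.eq_iff] at h2
    revert h2
    decide
  have hinv' : swapAut * invAut * swapAut ∈ Δ := mul_mem (mul_mem hswap hinv) hswap
  have key0 : ∀ τ : MulAut (FreeGroup (Fin 2)), τ (of 0) = of 0 → ∀ q, τ (of 1) = mk [(1, q)] →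
      τ ∈ Δ := by
    intro τ h0 q h1
    cases q
    · have : τ = swapAut * invAut * swapAut := by
        apply mulAut_ext_two
        · simp [h0, swapAut, invAut, MulAut.mul_apply]
        · simp [h1, swapAut, invAut, MulAut.mul_apply]
          rfl
      rwa [this]
    · have : τ = 1 := mulAut_ext_two h0 h1
      rw [this]
      exact one_mem Δ
  have key1 : ∀ τ : MulAut (FreeGroup (Fin 2)), ∀ p q, τ (of 0) = mk [(0, p)] →
      τ (of 1) = mk [(1, q)] → τ ∈ Δ := by
    intro τ p q h0 h1
    cases p
    · rw [← Subgroup.mul_mem_cancel_right Δ hinv]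
      refine key0 _ ?_ q ?_
      · simp [MulAut.mul_apply, invAut, h0, invRev]
        rfl
      · simp [MulAut.mul_apply, invAut, h1]
    · exact key0 _ h0 q h1
  obtain ⟨i, p⟩ := l
  obtain ⟨j, q⟩ := m
  fin_cases i <;> fin_cases j
  · exact absurd rfl hlm
  · exact key1 τ p q h0 h1
  · rw [← Subgroup.mul_mem_cancel_right Δ hswap]
    refine key1 _ q p ?_ ?_
    · simpa [MulAut.mul_apply, swapAut] using h1
    · simpa [MulAut.mul_apply, swapAut] using h0
  · exact absurd rfl hlm

/-- Nielsen's theorem in rank two: the automorphism group of the free group of rank two is generated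
by the Nielsen moves and the inner automorphisms. -/
theorem eq_top_of_nielsen (hconj : ∀ g, MulAut.conj g ∈ Δ) (hswap : swapAut ∈ Δ)
    (hinv : invAut ∈ Δ) (hmul : mulAutXY ∈ Δ) : Δ = ⊤ := by
  rw [eq_top_iff]
  rintro σ -
  let total (δ : MulAut (FreeGroup (Fin 2))) : ℕ := norm (δ (of 0)) + norm (δ (of 1))
  obtain ⟨δ₀, hδ₀, hmin⟩ : ∃ δ ∈ Δ, ∀ δ' ∈ Δ, total (σ * δ) ≤ total (σ * δ') := by
    have := exists_minimal_of_wellFoundedLT (fun n => ∃ δ ∈ Δ, total (σ * δ) = n)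
      ⟨_, 1, one_mem Δ, rfl⟩
    obtain ⟨n, ⟨δ, hδ, rfl⟩, hn⟩ := this
    refine ⟨δ, hδ, fun δ' hδ' => ?_⟩
    by_contra! h
    have := hn ⟨δ', hδ', rfl⟩ h.le
    omega
  let S : Set (FreeGroup (Fin 2) × FreeGroup (Fin 2)) :=
    {p | ∃ δ ∈ Δ, p = ((σ * δ) (of 0), (σ * δ) (of 1)) ∧ total (σ * δ) = total (σ * δ₀)}
  have hS : IsNielsenMinimal S := by
    constructor
    · rintro _ _ ⟨δ, hδ, h, ht⟩
      obtain ⟨rfl, rfl⟩ := Prod.mk.inj h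
      refine ⟨δ * swapAut, mul_mem hδ hswap, ?_, ?_⟩
      · simp [MulAut.mul_apply, swapAut]
      · rw [← ht]
        simp [total, MulAut.mul_apply, swapAut, add_comm]
    · rintro _ _ ⟨δ, hδ, h, ht⟩
      obtain ⟨rfl, rfl⟩ := Prod.mk.inj h
      refine ⟨δ * invAut, mul_mem hδ hinv, ?_, ?_⟩
      · simp [MulAut.mul_apply, invAut]
      · rw [← ht]
        simp [total, MulAut.mul_apply, invAut]
    · rintro _ _ ⟨δ, hδ, h, ht⟩
      obtain ⟨rfl, rfl⟩ := Prod.mk.inj h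
      have := hmin _ (mul_mem hδ hmul)
      rw [← ht] at this
      simpa [total, MulAut.mul_apply, mulAutXY] using this
    · rintro _ _ ⟨δ, hδ, h, ht⟩ hn
      obtain ⟨rfl, rfl⟩ := Prod.mk.inj h
      refine ⟨δ * mulAutXY, mul_mem hδ hmul, ?_, ?_⟩
      · simp [MulAut.mul_apply, mulAutXY]
      · rw [← ht]
        simpa [total, MulAut.mul_apply, mulAutXY] using hn
    · rintro _ _ ⟨δ, hδ, h, ht⟩ e
      obtain ⟨rfl, rfl⟩ := Prod.mk.inj h
      have := hmin _ (mul_mem (hconj ((σ)⁻¹ e⁻¹)) hδ)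
      rw [← ht] at this
      simpa [total, MulAut.mul_apply] using this
    · rintro _ _ ⟨δ, hδ, h, ht⟩
      obtain ⟨rfl, rfl⟩ := Prod.mk.inj h
      simp
  -- A minimal element of the coset does not shorten words, so its inverse maps letters to letters.
  have hle := norm_le_norm_map_of_isNielsenMinimal hS (f := (σ * δ₀).toMonoidHom)
    ⟨δ₀, hδ₀, rfl, rfl⟩
  have hletter : ∀ i : Fin 2, ∃ l, (σ * δ₀)⁻¹ (of i) = mk [l] := by
    intro i
    have h1 := hle ((σ * δ₀)⁻¹ (of i))
    have h2 : (σ * δ₀).toMonoidHom ((σ * δ₀)⁻¹ (of i)) = of i := (σ * δ₀).apply_symm_apply _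
    rw [h2, norm_of] at h1
    have h3 : norm ((σ * δ₀)⁻¹ (of i)) ≠ 0 := by simp
    obtain ⟨l, hl⟩ := List.length_eq_one_iff.1 (le_antisymm h1 (Nat.one_le_iff_ne_zero.2 h3))
    exact ⟨l, by rw [← hl, mk_toWord]⟩
  obtain ⟨l, hl⟩ := hletter 0
  obtain ⟨m, hm⟩ := hletter 1
  have := mem_of_permutes_letters hswap hinv hl hm
  rwa [inv_mem_iff, Subgroup.mul_mem_cancel_right Δ hδ₀] at this

end

end FreeGroup

open FreeGroup hiding map_mul map_one map_inv

namespace AutF2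

/-! ### Some automorphisms of the free group of rank two -/

/-- The free group of rank two, with basis `x = of 0`, `y = of 1`. -/
abbrev F2 := FreeGroup (Fin 2)

/-- The hyperelliptic involution `x ↦ x⁻¹`, `y ↦ y⁻¹`. -/
def iota : MulAut F2 :=
  mulAutOfLift ![(of 0)⁻¹, (of 1)⁻¹] ![(of 0)⁻¹, (of 1)⁻¹] (by simp [Fin.forall_fin_two])
    (by simp [Fin.forall_fin_two])

/-- The automorphism `x ↦ x`, `y ↦ x ^ 2 * y`. -/
def alpha : MulAut F2 :=
  mulAutOfLift ![of 0, of 0 * of 0 * of 1] ![of 0, (of 0)⁻¹ * (of 0)⁻¹ * of 1]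
    (by simp [Fin.forall_fin_two, mul_assoc]) (by simp [Fin.forall_fin_two, mul_assoc])

/-- The automorphism `x ↦ x * y ^ (-2)`, `y ↦ y`. -/
def beta : MulAut F2 :=
  mulAutOfLift ![of 0 * (of 1)⁻¹ * (of 1)⁻¹, of 1] ![of 0 * of 1 * of 1, of 1]
    (by simp [Fin.forall_fin_two, mul_assoc]) (by simp [Fin.forall_fin_two, mul_assoc])

/-- The automorphism of order three `x ↦ y ↦ (x * y)⁻¹ ↦ x`. -/
def rho : MulAut F2 :=
  mulAutOfLift ![of 1, (of 1)⁻¹ * (of 0)⁻¹] ![(of 1)⁻¹ * (of 0)⁻¹, of 0]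
    (by simp [Fin.forall_fin_two, mul_assoc]) (by simp [Fin.forall_fin_two])

/-- The involution `x ↦ y⁻¹`, `y ↦ x⁻¹`. -/
def tau : MulAut F2 :=
  mulAutOfLift ![(of 1)⁻¹, (of 0)⁻¹] ![(of 1)⁻¹, (of 0)⁻¹] (by simp [Fin.forall_fin_two])
    (by simp [Fin.forall_fin_two])

@[simp] theorem iota_zero : iota (of 0) = (of 0)⁻¹ := mulAutOfLift_of ..
@[simp] theorem iota_one : iota (of 1) = (of 1)⁻¹ := mulAutOfLift_of ..
@[simp] theorem alpha_zero : alpha (of 0) = of 0 := mulAutOfLift_of ..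
@[simp] theorem alpha_one : alpha (of 1) = of 0 * of 0 * of 1 := mulAutOfLift_of ..
@[simp] theorem beta_zero : beta (of 0) = of 0 * (of 1)⁻¹ * (of 1)⁻¹ := mulAutOfLift_of ..
@[simp] theorem beta_one : beta (of 1) = of 1 := mulAutOfLift_of ..
@[simp] theorem rho_zero : rho (of 0) = of 1 := mulAutOfLift_of ..
@[simp] theorem rho_one : rho (of 1) = (of 1)⁻¹ * (of 0)⁻¹ := mulAutOfLift_of ..
@[simp] theorem tau_zero : tau (of 0) = (of 1)⁻¹ := mulAutOfLift_of ..
@[simp] theorem tau_one : tau (of 1) = (of 0)⁻¹ := mulAutOfLift_of ..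
@[simp] theorem invAut_zero : invAut (of 0) = (of 0)⁻¹ := mulAutOfLift_of ..
@[simp] theorem invAut_one : invAut (of 1) = of 1 := mulAutOfLift_of ..

theorem conj_apply_mul (σ : MulAut F2) (g : F2) :
    σ * MulAut.conj g = MulAut.conj (σ g) * σ := by
  ext w
  simp [MulAut.mul_apply]

theorem iota_mul_iota : iota * iota = 1 := by
  apply mulAut_ext_two <;> simp [MulAut.mul_apply]

theorem tau_mul_tau : tau * tau = 1 := by
  apply mulAut_ext_two <;> simp [MulAut.mul_apply]

theorem invAut_mul_invAut : invAut * invAut = 1 := by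
  apply mulAut_ext_two <;> simp [MulAut.mul_apply]

theorem rho_mul_rho_mul_rho : rho * rho * rho = 1 := by
  apply mulAut_ext_two <;> simp [MulAut.mul_apply]

theorem tau_mul_rho : tau * rho = rho * rho * tau := by
  apply mulAut_ext_two <;> simp [MulAut.mul_apply, mul_assoc]

theorem rho_mul_alpha : rho * alpha = beta * rho := by
  apply mulAut_ext_two <;> simp [MulAut.mul_apply, mul_assoc]

theorem rho_mul_beta : rho * beta * rho * rho * alpha * beta =
    MulAut.conj ((of 1)⁻¹ * (of 0)⁻¹ * (of 1)⁻¹ * (of 1)⁻¹) * iota := by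
  apply mulAut_ext_two <;> simp [MulAut.mul_apply, mul_assoc]

theorem rho_mul_iota : rho * iota = MulAut.conj (of 1)⁻¹ * iota * rho := by
  apply mulAut_ext_two <;> simp [MulAut.mul_apply, mul_assoc]

theorem tau_mul_iota : tau * iota = iota * tau := by
  apply mulAut_ext_two <;> simp [MulAut.mul_apply]

theorem tau_mul_alpha : tau * alpha * tau * beta = 1 := by
  apply mulAut_ext_two <;> simp [MulAut.mul_apply, mul_assoc]

theorem invAut_mul_alpha : invAut * alpha * invAut * alpha = 1 := by
  apply mulAut_ext_two <;> simp [MulAut.mul_apply, mul_assoc]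

theorem invAut_mul_beta : invAut * beta * invAut * beta = MulAut.conj (of 1 * of 1) := by
  apply mulAut_ext_two <;> simp [MulAut.mul_apply, mul_assoc]

theorem invAut_mul_iota : invAut * iota = iota * invAut := by
  apply mulAut_ext_two <;> simp [MulAut.mul_apply]

theorem invAut_mul_rho : invAut * rho * invAut = iota * beta * rho := by
  apply mulAut_ext_two <;> simp [MulAut.mul_apply, mul_assoc]

theorem invAut_mul_tau : invAut * tau * invAut * tau = iota := by
  apply mulAut_ext_two <;> simp [MulAut.mul_apply]

theorem iota_mul_alpha : iota * alpha * iota = MulAut.conj ((of 0)⁻¹ * (of 0)⁻¹) * alpha := by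
  apply mulAut_ext_two <;> simp [MulAut.mul_apply, mul_assoc]

theorem iota_mul_beta : iota * beta * iota = MulAut.conj ((of 1)⁻¹ * (of 1)⁻¹) * beta := by
  apply mulAut_ext_two <;> simp [MulAut.mul_apply, mul_assoc]

theorem swapAut_eq : swapAut = tau * iota := by
  apply mulAut_ext_two <;> simp [MulAut.mul_apply, swapAut]

theorem mulAutXY_eq : mulAutXY = rho * tau * (iota * invAut) := by
  apply mulAut_ext_two <;> simp [MulAut.mul_apply, mulAutXY]

end AutF2

/-- An element of finite order that conjugates a subgroup into itself normalises it. -/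
theorem Subgroup.mem_normalizer_of_pow_eq_one {G : Type*} [Group G] {U : Subgroup G} {g : G} {n : ℕ}
    (hg : g ^ (n + 1) = 1) (h : ∀ u ∈ U, g * u * g⁻¹ ∈ U) :
    g ∈ Subgroup.normalizer (U : Set G) := by
  have hpow : ∀ (k : ℕ), ∀ u ∈ U, g ^ k * u * (g ^ k)⁻¹ ∈ U := by
    intro k
    induction k with
    | zero => simp
    | succ k ih =>
      intro u hu
      have := h _ (ih u hu)
      rwa [show g * (g ^ k * u * (g ^ k)⁻¹) * g⁻¹ = g ^ (k + 1) * u * (g ^ (k + 1))⁻¹ by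
        rw [pow_succ']; group] at this
  refine Subgroup.mem_normalizer_iff.2 fun u => ⟨h u, fun hu => ?_⟩
  have h1 := hpow n _ hu
  have h2 : g ^ n * (g * u * g⁻¹) * (g ^ n)⁻¹ = g ^ (n + 1) * u * (g ^ (n + 1))⁻¹ := by
    rw [pow_succ]; group
  rwa [h2, hg, one_mul, inv_one, mul_one] at h1

/-- If `r`, `t`, `e` satisfy the relations of a symmetric group of order six times a central
involution, then the elements `r ^ i * t ^ j * e ^ k` form a subgroup. -/
def Subgroup.ofTriple {G : Type*} [Group G] {r t e : G} (hr : r ^ 3 = 1) (ht : t ^ 2 = 1)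
    (he : e ^ 2 = 1) (htr : t * r = r ^ 2 * t) (her : Commute e r) (het : Commute e t) :
    Subgroup G :=
  have htri : ∀ j i : ℕ, t ^ j * r ^ i = r ^ (2 ^ j * i) * t ^ j := by
    intro j i
    have h1 : SemiconjBy t r (r ^ 2) := htr
    induction j with
    | zero => simp
    | succ j ih =>
      have h2 : t * r ^ (2 ^ j * i) = r ^ (2 * (2 ^ j * i)) * t := by
        rw [pow_mul r 2]
        exact h1.pow_right _
      rw [pow_succ', mul_assoc, ih, ← mul_assoc, h2, mul_assoc, pow_succ', mul_assoc 2]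
  { carrier := {g | ∃ i j k : ℕ, g = r ^ i * t ^ j * e ^ k}
    one_mem' := ⟨0, 0, 0, by simp⟩
    mul_mem' := by
      rintro _ _ ⟨i, j, k, rfl⟩ ⟨i', j', k', rfl⟩
      refine ⟨i + 2 ^ j * i', j + j', k + k', ?_⟩
      have h1 : Commute (e ^ k) (r ^ i' * t ^ j') :=
        ((her.pow_right i').mul_right (het.pow_right j')).pow_left k
      calc r ^ i * t ^ j * e ^ k * (r ^ i' * t ^ j' * e ^ k')
          = r ^ i * t ^ j * (e ^ k * (r ^ i' * t ^ j')) * e ^ k' := by simp only [mul_assoc]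
        _ = r ^ i * (t ^ j * r ^ i') * t ^ j' * e ^ k * e ^ k' := by
            rw [h1.eq]
            simp only [mul_assoc]
        _ = r ^ (i + 2 ^ j * i') * t ^ (j + j') * e ^ (k + k') := by
            rw [htri, pow_add, pow_add, pow_add]
            simp only [mul_assoc]
    inv_mem' := by
      rintro _ ⟨i, j, k, rfl⟩
      refine ⟨2 ^ j * (2 * i), j, k, ?_⟩
      have h1 : Commute (e ^ k) (t ^ j * r ^ (2 * i)) :=
        ((het.pow_right j).mul_right (her.pow_right _)).pow_left k
      have h2 : r ^ i * r ^ (2 * i) = 1 := by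
        rw [← pow_add, show i + 2 * i = 3 * i by ring, pow_mul, hr, one_pow]
      have h3 : t ^ j * t ^ j = 1 := by rw [← pow_add, ← two_mul, pow_mul, ht, one_pow]
      have h4 : e ^ k * e ^ k = 1 := by rw [← pow_add, ← two_mul, pow_mul, he, one_pow]
      rw [inv_eq_iff_mul_eq_one, ← htri]
      calc r ^ i * t ^ j * e ^ k * (t ^ j * r ^ (2 * i) * e ^ k)
          = r ^ i * t ^ j * (e ^ k * (t ^ j * r ^ (2 * i))) * e ^ k := by simp only [mul_assoc]
        _ = r ^ i * (t ^ j * t ^ j) * r ^ (2 * i) * (e ^ k * e ^ k) := by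
            rw [h1.eq]
            simp only [mul_assoc]
        _ = 1 := by rw [h3, h4, mul_one, mul_one, h2] }

namespace AutF2

/-! ### Automorphisms acting trivially modulo four -/

theorem normal_range_conj : (MulAut.conj : F2 →* MulAut F2).range.Normal := by
  constructor
  rintro _ ⟨g, rfl⟩ σ
  exact ⟨σ g, by rw [conj_apply_mul, mul_inv_cancel_right]⟩

/-- The group generated by `alpha` and `beta`. -/
def Phi : Subgroup (MulAut F2) := Subgroup.closure {alpha, beta}

/-- The group generated by `alpha`, `beta` and the inner automorphisms. -/
def InnPhi : Subgroup (MulAut F2) := MulAut.conj.range ⊔ Phi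

/-- The group generated by `alpha`, `beta`, the inner automorphisms and the hyperelliptic
involution. -/
def InnPhiIota : Subgroup (MulAut F2) := InnPhi ⊔ Subgroup.zpowers iota

theorem alpha_mem_Phi : alpha ∈ Phi := Subgroup.subset_closure (by simp)

theorem beta_mem_Phi : beta ∈ Phi := Subgroup.subset_closure (by simp)

theorem Phi_le_InnPhi : Phi ≤ InnPhi := le_sup_right

theorem conj_mem_InnPhi (g : F2) : MulAut.conj g ∈ InnPhi :=
  (le_sup_left : MulAut.conj.range ≤ InnPhi) ⟨g, rfl⟩

theorem InnPhi_le_InnPhiIota : InnPhi ≤ InnPhiIota := le_sup_left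

theorem iota_mem : iota ∈ InnPhiIota :=
  (le_sup_right : _ ≤ InnPhiIota) (Subgroup.mem_zpowers iota)

theorem conj_mem (g : F2) : MulAut.conj g ∈ InnPhiIota := InnPhi_le_InnPhiIota (conj_mem_InnPhi g)

theorem alpha_mem : alpha ∈ InnPhiIota := InnPhi_le_InnPhiIota (Phi_le_InnPhi alpha_mem_Phi)

theorem beta_mem : beta ∈ InnPhiIota := InnPhi_le_InnPhiIota (Phi_le_InnPhi beta_mem_Phi)

theorem conj_InnPhi_mem {H : Subgroup (MulAut F2)} {σ : MulAut F2}
    (hconj : ∀ g, MulAut.conj g ∈ H) (ha : σ * alpha * σ⁻¹ ∈ H) (hb : σ * beta * σ⁻¹ ∈ H) :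
    ∀ u ∈ InnPhi, σ * u * σ⁻¹ ∈ H := by
  have : InnPhi ≤ H.comap (MulAut.conj σ).toMonoidHom := by
    refine sup_le ?_ ((Subgroup.closure_le _).2 ?_)
    · rintro _ ⟨g, rfl⟩
      change σ * MulAut.conj g * σ⁻¹ ∈ H
      rw [conj_apply_mul, mul_inv_cancel_right]
      exact hconj _
    · rintro u (rfl | rfl)
      · exact ha
      · exact hb
  exact this

theorem conj_InnPhiIota_mem {σ : MulAut F2} (ha : σ * alpha * σ⁻¹ ∈ InnPhiIota)
    (hb : σ * beta * σ⁻¹ ∈ InnPhiIota) (hi : σ * iota * σ⁻¹ ∈ InnPhiIota) :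
    ∀ u ∈ InnPhiIota, σ * u * σ⁻¹ ∈ InnPhiIota := by
  have : InnPhiIota ≤ InnPhiIota.comap (MulAut.conj σ).toMonoidHom := by
    refine sup_le (conj_InnPhi_mem conj_mem ha hb) ?_
    rw [Subgroup.zpowers_le]
    exact hi
  exact this

theorem iota_inv : iota⁻¹ = iota := inv_eq_of_mul_eq_one_right iota_mul_iota

theorem tau_inv : tau⁻¹ = tau := inv_eq_of_mul_eq_one_right tau_mul_tau

theorem invAut_inv : invAut⁻¹ = invAut := inv_eq_of_mul_eq_one_right invAut_mul_invAut

theorem rho_inv : rho⁻¹ = rho * rho := by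
  rw [inv_eq_iff_mul_eq_one, ← mul_assoc, rho_mul_rho_mul_rho]

theorem rho_mem_normalizer : rho ∈ Subgroup.normalizer (InnPhiIota : Set (MulAut F2)) := by
  refine Subgroup.mem_normalizer_of_pow_eq_one (n := 2) ?_ (conj_InnPhiIota_mem ?_ ?_ ?_)
  · rw [pow_succ, pow_two, rho_mul_rho_mul_rho]
  · rw [rho_mul_alpha, mul_inv_cancel_right]
    exact beta_mem
  · have h := rho_mul_beta
    rw [mul_assoc (rho * beta), ← rho_inv, ← eq_mul_inv_iff_mul_eq, ← eq_mul_inv_iff_mul_eq] at h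
    rw [h]
    exact mul_mem (mul_mem (mul_mem (conj_mem _) iota_mem) (inv_mem beta_mem)) (inv_mem alpha_mem)
  · rw [rho_mul_iota, mul_inv_cancel_right]
    exact mul_mem (conj_mem _) iota_mem

theorem tau_mem_normalizer : tau ∈ Subgroup.normalizer (InnPhiIota : Set (MulAut F2)) := by
  have h1 : tau * alpha * tau = beta⁻¹ := eq_inv_of_mul_eq_one_left tau_mul_alpha
  have h2 : tau * beta * tau = alpha⁻¹ := by
    have h3 : tau * beta⁻¹ * tau⁻¹ = alpha := by
      rw [← h1, mul_inv_eq_iff_eq_mul, ← mul_assoc, ← mul_assoc, tau_mul_tau, one_mul]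
    rw [← h3, tau_inv, mul_inv_rev, mul_inv_rev, inv_inv, tau_inv, mul_assoc]
  refine Subgroup.mem_normalizer_of_pow_eq_one (n := 1) ?_ (conj_InnPhiIota_mem ?_ ?_ ?_)
  · rw [pow_two, tau_mul_tau]
  · rw [tau_inv, h1]
    exact inv_mem beta_mem
  · rw [tau_inv, h2]
    exact inv_mem alpha_mem
  · rw [tau_mul_iota, mul_inv_cancel_right]
    exact iota_mem

theorem inv_mem_normalizer : invAut ∈ Subgroup.normalizer (InnPhiIota : Set (MulAut F2)) := by
  refine Subgroup.mem_normalizer_of_pow_eq_one (n := 1) ?_ (conj_InnPhiIota_mem ?_ ?_ ?_)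
  · rw [pow_two, invAut_mul_invAut]
  · rw [invAut_inv, eq_inv_of_mul_eq_one_left invAut_mul_alpha]
    exact inv_mem alpha_mem
  · rw [invAut_inv, eq_mul_inv_of_mul_eq invAut_mul_beta]
    exact mul_mem (conj_mem _) (inv_mem beta_mem)
  · rw [invAut_mul_iota, mul_inv_cancel_right]
    exact iota_mem

instance normal_InnPhiIota : InnPhiIota.Normal := by
  rw [← Subgroup.normalizer_eq_top_iff]
  have hle := Subgroup.le_normalizer (H := InnPhiIota)
  refine eq_top_of_nielsen (fun g => hle (conj_mem g)) ?_ inv_mem_normalizer ?_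
  · rw [swapAut_eq]
    exact mul_mem tau_mem_normalizer (hle iota_mem)
  · rw [mulAutXY_eq]
    exact mul_mem (mul_mem rho_mem_normalizer tau_mem_normalizer)
      (mul_mem (hle iota_mem) inv_mem_normalizer)

/-- Modulo `InnPhiIota`, the automorphism group of the free group of rank two is the group
`GL₂(ℤ) / {± matrices that are the identity modulo two and have determinant one}` of order twelve,
generated by `rho`, `tau` and the central element `invAut`. -/
theorem exists_eq_mul_pow (σ : MulAut F2) :
    ∃ u ∈ InnPhiIota, ∃ i j k : ℕ, σ = u * (rho ^ i * tau ^ j * invAut ^ k) := by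
  let p := QuotientGroup.mk' InnPhiIota
  have hp : ∀ u ∈ InnPhiIota, p u = 1 := fun u hu => (QuotientGroup.eq_one_iff u).2 hu
  have hr : p rho ^ 3 = 1 := by
    rw [← map_pow, pow_succ, pow_two, rho_mul_rho_mul_rho, map_one]
  have ht : p tau ^ 2 = 1 := by rw [← map_pow, pow_two, tau_mul_tau, map_one]
  have he : p invAut ^ 2 = 1 := by rw [← map_pow, pow_two, invAut_mul_invAut, map_one]
  have htr : p tau * p rho = p rho ^ 2 * p tau := by
    rw [pow_two, ← map_mul, tau_mul_rho, map_mul, map_mul]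
  have her : Commute (p invAut) (p rho) := by
    have h1 := congrArg (p · * p invAut) invAut_mul_rho
    rwa [map_mul, map_mul, map_mul, map_mul, hp _ iota_mem, hp _ beta_mem, one_mul, one_mul,
      mul_assoc, ← pow_two, he, mul_one] at h1
  have het : Commute (p invAut) (p tau) := by
    have h1 := congrArg p invAut_mul_tau
    rw [mul_assoc, map_mul, hp _ iota_mem, mul_eq_one_iff_eq_inv, ← map_inv, mul_inv_rev, tau_inv,
      invAut_inv, map_mul, map_mul] at h1
    exact h1
  let Δ : Subgroup (MulAut F2) := (Subgroup.ofTriple hr ht he htr her het).comap p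
  have hΔ : Δ = ⊤ := by
    refine eq_top_of_nielsen (fun g => ⟨0, 0, 0, ?_⟩) ⟨0, 1, 0, ?_⟩ ⟨0, 0, 1, ?_⟩ ⟨1, 1, 1, ?_⟩
    · simp [hp _ (conj_mem g)]
    · simp [swapAut_eq, hp _ iota_mem]
    · simp
    · simp [mulAutXY_eq, hp _ iota_mem]
  obtain ⟨i, j, k, h⟩ : σ ∈ Δ := hΔ ▸ Subgroup.mem_top σ
  refine ⟨σ * (rho ^ i * tau ^ j * invAut ^ k)⁻¹, ?_, i, j, k, by rw [inv_mul_cancel_right]⟩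
  rw [← QuotientGroup.eq_one_iff]
  change p _ = 1
  rw [map_mul, map_inv, h, map_mul, map_mul, map_pow, map_pow, map_pow, mul_inv_cancel]

/-- The abelianisation of the free group of rank two, modulo four. -/
def abMod4 : F2 →* Multiplicative (Fin 2 → ZMod 4) :=
  FreeGroup.lift fun j => Multiplicative.ofAdd (Pi.single j 1)

/-- The matrix of an endomorphism on the abelianisation modulo four. -/
def matrixMod4 (σ : MulAut F2) : Matrix (Fin 2) (Fin 2) (ZMod 4) :=
  Matrix.of fun i j => (abMod4 (σ (of j))).toAdd i

theorem abMod4_apply (σ : MulAut F2) (w : F2) :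
    (abMod4 (σ w)).toAdd = (matrixMod4 σ).mulVec (abMod4 w).toAdd := by
  let f : F2 →* Multiplicative (Fin 2 → ZMod 4) :=
    (AddMonoidHom.toMultiplicative (matrixMod4 σ).mulVecLin.toAddMonoidHom).comp abMod4
  have : abMod4.comp σ.toMonoidHom = f := by
    refine ext_hom _ _ fun j => ?_
    apply Multiplicative.toAdd.injective
    ext i
    simp [f, abMod4, matrixMod4]
  exact congrArg Multiplicative.toAdd (DFunLike.congr_fun this w)

theorem matrixMod4_mul (σ τ : MulAut F2) : matrixMod4 (σ * τ) = matrixMod4 σ * matrixMod4 τ := by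
  ext i j
  have := congrFun (abMod4_apply σ (τ (of j))) i
  rw [matrixMod4, Matrix.of_apply, MulAut.mul_apply, this, Matrix.mul_apply]
  rfl

theorem matrixMod4_one : matrixMod4 1 = 1 := by
  ext i j
  simp [matrixMod4, abMod4, Matrix.one_apply, Pi.single_apply]

/-- The matrix of an automorphism on the abelianisation modulo four, as a homomorphism. -/
def matrixMod4Hom : MulAut F2 →* Matrix (Fin 2) (Fin 2) (ZMod 4) where
  toFun := matrixMod4
  map_one' := matrixMod4_one
  map_mul' := matrixMod4_mul

theorem matrixMod4Hom_eq (σ : MulAut F2) : matrixMod4Hom σ =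
    !![(abMod4 (σ (of 0))).toAdd 0, (abMod4 (σ (of 1))).toAdd 0;
      (abMod4 (σ (of 0))).toAdd 1, (abMod4 (σ (of 1))).toAdd 1] := by
  ext i j
  fin_cases i <;> fin_cases j <;> rfl

theorem matrixMod4Hom_conj (g : F2) : matrixMod4Hom (MulAut.conj g) = 1 := by
  rw [← matrixMod4_one]
  ext i j
  simp [matrixMod4Hom, matrixMod4]

theorem matrixMod4Hom_iota : matrixMod4Hom iota = !![-1, 0; 0, -1] := by
  rw [matrixMod4Hom_eq]
  simp [abMod4]

theorem matrixMod4Hom_alpha : matrixMod4Hom alpha = !![1, 2; 0, 1] := by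
  rw [matrixMod4Hom_eq]
  simp [abMod4]
  decide

theorem matrixMod4Hom_beta : matrixMod4Hom beta = !![1, 0; -2, 1] := by
  rw [matrixMod4Hom_eq]
  simp [abMod4]
  decide

theorem matrixMod4Hom_rho : matrixMod4Hom rho = !![0, -1; 1, -1] := by
  rw [matrixMod4Hom_eq]
  simp [abMod4]

theorem matrixMod4Hom_tau : matrixMod4Hom tau = !![0, -1; -1, 0] := by
  rw [matrixMod4Hom_eq]
  simp [abMod4]

theorem matrixMod4Hom_inv : matrixMod4Hom invAut = !![-1, 0; 0, 1] := by
  rw [matrixMod4Hom_eq]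
  simp [abMod4]

/-- The matrices modulo four that are the identity modulo two and have two equal diagonal entries
in `S`. -/
def IsSanov (S : Finset (ZMod 4)) (m : Matrix (Fin 2) (Fin 2) (ZMod 4)) : Prop :=
  m 0 0 = m 1 1 ∧ m 0 0 ∈ S ∧ 2 * m 0 1 = 0 ∧ 2 * m 1 0 = 0

instance (S : Finset (ZMod 4)) (m : Matrix (Fin 2) (Fin 2) (ZMod 4)) : Decidable (IsSanov S m) :=
  inferInstanceAs (Decidable (_ ∧ _))

theorem IsSanov.mul {S : Finset (ZMod 4)} (hS : S = {1} ∨ S = {1, -1})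
    {m n : Matrix (Fin 2) (Fin 2) (ZMod 4)} (hm : IsSanov S m) (hn : IsSanov S n) :
    IsSanov S (m * n) := by
  obtain ⟨m1, m2, m3, m4⟩ := hm
  obtain ⟨n1, n2, n3, n4⟩ := hn
  simp only [IsSanov, Matrix.mul_apply, Fin.sum_univ_two]
  revert m1 m2 m3 m4 n1 n2 n3 n4
  generalize m 0 0 = a, m 0 1 = b, m 1 0 = c, m 1 1 = d
  generalize n 0 0 = a', n 0 1 = b', n 1 0 = c', n 1 1 = d'
  rintro rfl h2 h3 h4 rfl h2' h3' h4'
  have hbc : ∀ u v : ZMod 4, 2 * u = 0 → 2 * v = 0 → u * v = 0 := by decide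
  rw [hbc b c' h3 h4', hbc c b' h4 h3']
  refine ⟨by ring, ?_, by linear_combination a * h3' + a' * h3, by
    linear_combination a * h4' + a' * h4⟩
  rcases hS with rfl | rfl
  · simp only [Finset.mem_singleton] at h2 h2' ⊢
    subst h2 h2'
    decide
  · simp only [Finset.mem_singleton, Finset.mem_insert] at h2 h2' ⊢
    rcases h2 with rfl | rfl <;> rcases h2' with rfl | rfl <;> decide

theorem IsSanov.mul_self {m : Matrix (Fin 2) (Fin 2) (ZMod 4)} (hm : IsSanov {1, -1} m) :
    m * m = 1 := by
  obtain ⟨m1, m2, m3, m4⟩ := hm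
  have hbc : ∀ u v : ZMod 4, 2 * u = 0 → 2 * v = 0 → u * v = 0 := by decide
  have h1 : m 0 0 * m 0 0 = 1 := by
    simp only [Finset.mem_singleton, Finset.mem_insert] at m2
    rcases m2 with h | h <;> rw [h] <;> decide
  ext i j
  fin_cases i <;> fin_cases j <;> simp [Matrix.mul_apply, Fin.sum_univ_two]
  · rw [hbc _ _ m3 m4, h1, add_zero]
  · rw [← m1]
    linear_combination m 0 0 * m3
  · rw [← m1]
    linear_combination m 0 0 * m4
  · rw [hbc _ _ m4 m3, ← m1, h1, zero_add]

/-- The automorphisms whose matrix modulo four lies in the group described by `IsSanov S`. -/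
def sanovSubgroup (S : Finset (ZMod 4)) (hS : S = {1} ∨ S = {1, -1}) : Subgroup (MulAut F2) where
  carrier := {σ | IsSanov S (matrixMod4Hom σ)}
  one_mem' := by
    rcases hS with rfl | rfl <;> simp [IsSanov]
  mul_mem' := fun hσ hτ => by
    simp only [Set.mem_ofPred_eq, map_mul] at hσ hτ ⊢
    exact hσ.mul hS hτ
  inv_mem' := fun {σ} hσ => by
    simp only [Set.mem_ofPred_eq] at hσ ⊢
    have h1 : IsSanov {1, -1} (matrixMod4Hom σ) := by
      rcases hS with rfl | rfl
      · exact ⟨hσ.1, Finset.mem_insert.2 (Or.inl (Finset.mem_singleton.1 hσ.2.1)), hσ.2.2⟩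
      · exact hσ
    have h2 : matrixMod4Hom σ * matrixMod4Hom σ⁻¹ = 1 := by
      rw [← map_mul, mul_inv_cancel, map_one]
    have h3 : matrixMod4Hom σ⁻¹ = matrixMod4Hom σ := by
      rw [← one_mul (matrixMod4Hom σ⁻¹), ← h1.mul_self, mul_assoc, h2, mul_one]
    rwa [h3]

theorem InnPhi_le_sanovSubgroup (S : Finset (ZMod 4)) (hS : S = {1} ∨ S = {1, -1}) :
    InnPhi ≤ sanovSubgroup S hS := by
  have h1 : (1 : ZMod 4) ∈ S := by rcases hS with rfl | rfl <;> simp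
  refine sup_le ?_ ((Subgroup.closure_le _).2 ?_)
  · rintro _ ⟨g, rfl⟩
    change IsSanov S _
    rw [matrixMod4Hom_conj]
    simp [IsSanov, h1]
  · rintro u (rfl | rfl)
    · change IsSanov S _
      rw [matrixMod4Hom_alpha]
      simp [IsSanov, h1]
      decide
    · change IsSanov S _
      rw [matrixMod4Hom_beta]
      simp [IsSanov, h1]
      decide

theorem InnPhiIota_le_sanovSubgroup : InnPhiIota ≤ sanovSubgroup {1, -1} (Or.inr rfl) := by
  refine sup_le (InnPhi_le_sanovSubgroup _ _) (Subgroup.zpowers_le.2 ?_)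
  change IsSanov _ _
  rw [matrixMod4Hom_iota]
  simp [IsSanov]

theorem mem_InnPhi_or (u : MulAut F2) (hu : u ∈ InnPhiIota) : u ∈ InnPhi ∨ u * iota ∈ InnPhi := by
  have hi : ∀ v ∈ InnPhi, iota * v * iota ∈ InnPhi := by
    have := conj_InnPhi_mem (H := InnPhi) (σ := iota) conj_mem_InnPhi
    rw [iota_inv, iota_mul_alpha, iota_mul_beta] at this
    exact this (mul_mem (conj_mem_InnPhi _) (Phi_le_InnPhi alpha_mem_Phi))
      (mul_mem (conj_mem_InnPhi _) (Phi_le_InnPhi beta_mem_Phi))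
  have hn : InnPhiIota ≤ Subgroup.closure ((InnPhi : Set (MulAut F2)) ∪ {iota}) := by
    rw [Subgroup.closure_union, Subgroup.closure_eq, InnPhiIota, Subgroup.zpowers_eq_closure]
  refine Subgroup.closure_induction ?_ (Or.inl (one_mem _)) ?_ ?_ (hn hu)
  · rintro v (hv | rfl)
    · exact Or.inl hv
    · exact Or.inr (by rw [iota_mul_iota]; exact one_mem _)
  · rintro v w - - (hv | hv) (hw | hw)
    · exact Or.inl (mul_mem hv hw)
    · exact Or.inr (by rw [mul_assoc]; exact mul_mem hv hw)
    · refine Or.inr ?_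
      have := mul_mem hv (hi w hw)
      rwa [show v * iota * (iota * w * iota) = v * (iota * iota) * w * iota by
        simp only [mul_assoc], iota_mul_iota, mul_one] at this
    · refine Or.inl ?_
      have := mul_mem hv (hi _ hw)
      rwa [show v * iota * (iota * (w * iota) * iota) = v * (iota * iota) * w * (iota * iota) by
        simp only [mul_assoc], iota_mul_iota, mul_one, mul_one] at this
  · rintro v - (hv | hv)
    · exact Or.inl (inv_mem hv)
    · refine Or.inr ?_
      have := hi _ (inv_mem hv)
      rwa [mul_inv_rev, iota_inv, ← mul_assoc, iota_mul_iota, one_mul] at this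

/-- An automorphism that acts trivially on the abelianisation modulo four is the product of an inner
automorphism and an element of `Phi`. -/
theorem exists_eq_conj_mul_of_matrixMod4Hom_eq_one {σ : MulAut F2} (hσ : matrixMod4Hom σ = 1) :
    ∃ f : F2, ∃ φ ∈ Phi, σ = MulAut.conj f * φ := by
  have hU : σ ∈ InnPhiIota := by
    obtain ⟨u, hu, i, j, k, rfl⟩ := exists_eq_mul_pow σ
    refine mul_mem hu ?_
    have hs : IsSanov {1, -1} (matrixMod4Hom u) := InnPhiIota_le_sanovSubgroup hu
    have h1 : matrixMod4Hom (rho ^ i * tau ^ j * invAut ^ k) = matrixMod4Hom u := by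
      rw [map_mul] at hσ
      rw [← one_mul (matrixMod4Hom (_ * _)), ← hs.mul_self, mul_assoc, hσ, mul_one]
    have hr : rho ^ 3 = 1 := by rw [pow_succ, pow_two, rho_mul_rho_mul_rho]
    have ht : tau ^ 2 = 1 := by rw [pow_two, tau_mul_tau]
    have he : invAut ^ 2 = 1 := by rw [pow_two, invAut_mul_invAut]
    rw [pow_eq_pow_mod i hr, pow_eq_pow_mod j ht, pow_eq_pow_mod k he] at h1 ⊢
    rw [← h1, map_mul, map_mul, map_pow, map_pow, map_pow, matrixMod4Hom_rho, matrixMod4Hom_tau,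
      matrixMod4Hom_inv] at hs
    have hi := Nat.mod_lt i (show 0 < 3 by decide)
    have hj := Nat.mod_lt j (show 0 < 2 by decide)
    have hk := Nat.mod_lt k (show 0 < 2 by decide)
    generalize i % 3 = i' at *
    generalize j % 2 = j' at *
    generalize k % 2 = k' at *
    interval_cases i' <;> interval_cases j' <;> interval_cases k' <;>
      first | exact absurd hs (by decide) | simp
  have hV : σ ∈ InnPhi := by
    refine (mem_InnPhi_or σ hU).resolve_right fun h => ?_
    have h1 := (InnPhi_le_sanovSubgroup {1} (Or.inl rfl) h).2.1
    rw [map_mul, hσ, one_mul, matrixMod4Hom_iota] at h1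
    simp only [Finset.mem_singleton] at h1
    exact absurd h1 (by decide)
  have := normal_range_conj
  obtain ⟨_, ⟨f, rfl⟩, φ, hφ, h⟩ := Subgroup.mem_sup_of_normal_left.1 hV
  exact ⟨f, φ, hφ, h.symm⟩

/-! ### The mapping class group of the sphere with five punctures -/

/-- The action of `s` on the free group with basis `d`, `e₁`, `e₂`: it fixes `e₁`, `e₂` and
conjugates `d` by `(e₂ * e₁)⁻¹`. -/
def actS : MulAut (FreeGroup (Fin 3)) :=
  mulAutOfLift ![(of 1)⁻¹ * (of 2)⁻¹ * of 0 * of 2 * of 1, of 1, of 2]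
    ![of 2 * of 1 * of 0 * (of 1)⁻¹ * (of 2)⁻¹, of 1, of 2]
    (by simp [Fin.forall_fin_succ, mul_assoc]) (by simp [Fin.forall_fin_succ, mul_assoc])

/-- The action of `t` on the free group with basis `d`, `e₁`, `e₂`: it fixes `d`, `e₁` and
conjugates `e₂` by `e₁ * d`. -/
def actT : MulAut (FreeGroup (Fin 3)) :=
  mulAutOfLift ![of 0, of 1, of 1 * of 0 * of 2 * (of 0)⁻¹ * (of 1)⁻¹]
    ![of 0, of 1, (of 0)⁻¹ * (of 1)⁻¹ * of 2 * of 1 * of 0]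
    (by simp [Fin.forall_fin_succ, mul_assoc]) (by simp [Fin.forall_fin_succ, mul_assoc])

/-- The action of the free group on `s`, `t` on the free group on `d`, `e₁`, `e₂`. -/
def actHom : F2 →* MulAut (FreeGroup (Fin 3)) := FreeGroup.lift ![actS, actT]

/-- The semidirect product of the free group on `d`, `e₁`, `e₂` by the free group on `s`, `t`. It is
isomorphic to the pure mapping class group of the sphere with five punctures, two of which are
distinguished; the projection to the second factor forgets the first distinguished puncture. -/
abbrev PureFive : Type := FreeGroup (Fin 3) ⋊[actHom] F2

/-- The basis element `d` of the normal factor: a loop of one of two distinguished punctures around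
the other. -/
def genD : PureFive := SemidirectProduct.inl (of 0)

/-- The basis element `e₁` of the normal factor. -/
def genE₁ : PureFive := SemidirectProduct.inl (of 1)

/-- The basis element `e₂` of the normal factor. -/
def genE₂ : PureFive := SemidirectProduct.inl (of 2)

/-- The basis element `s` of the complement. -/
def genS : PureFive := SemidirectProduct.inr (of 0)

/-- The basis element `t` of the complement. -/
def genT : PureFive := SemidirectProduct.inr (of 1)

theorem genS_conj (w : FreeGroup (Fin 3)) :
    genS * SemidirectProduct.inl w * genS⁻¹ = SemidirectProduct.inl (actS w) := by
  rw [genS, ← map_inv, ← SemidirectProduct.inl_aut]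
  simp [actHom]

theorem genT_conj (w : FreeGroup (Fin 3)) :
    genT * SemidirectProduct.inl w * genT⁻¹ = SemidirectProduct.inl (actT w) := by
  rw [genT, ← map_inv, ← SemidirectProduct.inl_aut]
  simp [actHom]

theorem commute_genS_genE₁ : Commute genS genE₁ := by
  have h := genS_conj (of 1)
  rw [mul_inv_eq_iff_eq_mul, show actS (of 1) = of 1 from mulAutOfLift_of ..] at h
  exact h

theorem commute_genS_genE₂ : Commute genS genE₂ := by
  have h := genS_conj (of 2)
  rw [mul_inv_eq_iff_eq_mul, show actS (of 2) = of 2 from mulAutOfLift_of ..] at h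
  exact h

theorem commute_genT_genD : Commute genT genD := by
  have h := genT_conj (of 0)
  rw [mul_inv_eq_iff_eq_mul, show actT (of 0) = of 0 from mulAutOfLift_of ..] at h
  exact h

theorem commute_genT_genE₁ : Commute genT genE₁ := by
  have h := genT_conj (of 1)
  rw [mul_inv_eq_iff_eq_mul, show actT (of 1) = of 1 from mulAutOfLift_of ..] at h
  exact h

theorem genS_conj_genD : genS * genD * genS⁻¹ = genE₁⁻¹ * genE₂⁻¹ * genD * genE₂ * genE₁ := by
  have h := genS_conj (of 0)
  rw [show actS (of 0) = (of 1)⁻¹ * (of 2)⁻¹ * of 0 * of 2 * of 1 from mulAutOfLift_of ..] at h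
  simp only [map_mul, map_inv] at h
  exact h

theorem genT_conj_genE₂ :
    genT * genE₂ * genT⁻¹ = genE₁ * genD * genE₂ * genD⁻¹ * genE₁⁻¹ := by
  have h := genT_conj (of 2)
  rw [show actT (of 2) = of 1 * of 0 * of 2 * (of 0)⁻¹ * (of 1)⁻¹ from mulAutOfLift_of ..] at h
  simp only [map_mul, map_inv] at h
  exact h

/-- The loop `p₃` of the second distinguished puncture around the third of the other punctures. -/
def genP₃ : PureFive := genE₁ * genT⁻¹ * genD

/-- The loop `p₁` of the second distinguished puncture around the first of the other punctures. -/
def genP₁ : PureFive := genD * genP₃⁻¹ * genS⁻¹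

/-- The kernel of the map that forgets the second distinguished puncture, defined here by the
generators `d`, `s`, `p₃`, which are the loops of that puncture around the remaining ones. -/
def fibre : Subgroup PureFive := Subgroup.closure {genD, genS, genP₃}

theorem genD_mem : genD ∈ fibre := Subgroup.subset_closure (by simp)

theorem genS_mem : genS ∈ fibre := Subgroup.subset_closure (by simp)

theorem genP₃_mem : genP₃ ∈ fibre := Subgroup.subset_closure (by simp)

theorem fibre_eq_range :
    fibre = (FreeGroup.lift ![genD, genP₁, genP₃] : FreeGroup (Fin 3) →* PureFive).range := by
  apply le_antisymm
  · have h0 : genD ∈ (FreeGroup.lift ![genD, genP₁, genP₃]).range := ⟨of 0, by simp⟩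
    have h1 : genP₁ ∈ (FreeGroup.lift ![genD, genP₁, genP₃]).range := ⟨of 1, by simp⟩
    have h2 : genP₃ ∈ (FreeGroup.lift ![genD, genP₁, genP₃]).range := ⟨of 2, by simp⟩
    refine (Subgroup.closure_le _).2 ?_
    rintro _ (rfl | rfl | rfl)
    · exact h0
    · have : genS = genP₁⁻¹ * genD * genP₃⁻¹ := by
        rw [genP₁]
        group
      rw [this]
      exact mul_mem (mul_mem (inv_mem h1) h0) (inv_mem h2)
    · exact h2
  · refine FreeGroup.range_lift_le ?_
    rintro _ ⟨i, rfl⟩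
    fin_cases i
    · exact genD_mem
    · exact mul_mem (mul_mem genD_mem (inv_mem genP₃_mem)) (inv_mem genS_mem)
    · exact genP₃_mem

theorem mem_normalizer_fibre {g : PureFive}
    (h : ∀ u ∈ ({genD, genS, genP₃} : Set PureFive), g * u * g⁻¹ ∈ fibre)
    (h' : ∀ u ∈ ({genD, genS, genP₃} : Set PureFive), g⁻¹ * u * g ∈ fibre) :
    g ∈ Subgroup.normalizer (fibre : Set PureFive) := by
  have h1 : fibre ≤ fibre.comap (MulAut.conj g).toMonoidHom := (Subgroup.closure_le _).2 h
  have h2 : fibre ≤ fibre.comap (MulAut.conj g⁻¹).toMonoidHom := by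
    refine (Subgroup.closure_le _).2 fun u hu => ?_
    have := h' u hu
    change g⁻¹ * u * g⁻¹⁻¹ ∈ fibre
    rwa [inv_inv]
  refine Subgroup.mem_normalizer_iff.2 fun u => ⟨fun hu => h1 hu, fun hu => ?_⟩
  have h3 : g⁻¹ * (g * u * g⁻¹) * g⁻¹⁻¹ ∈ fibre := h2 hu
  rwa [show g⁻¹ * (g * u * g⁻¹) * g⁻¹⁻¹ = u by group] at h3

theorem commute_genE₂_genP₃ : Commute genE₂ genP₃ := by
  have h1 := genT_conj_genE₂
  have h2 := commute_genT_genE₁.inv_left.eq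
  rw [mul_inv_eq_iff_eq_mul] at h1
  have h3 : genP₃ = genT⁻¹ * genE₁ * genD := by rw [genP₃, h2]
  rw [Commute, SemiconjBy, h3, ← mul_left_cancel_iff (a := genT)]
  calc genT * (genE₂ * (genT⁻¹ * genE₁ * genD))
      = genT * genE₂ * (genT⁻¹ * genE₁ * genD) := by group
    _ = genT * (genT⁻¹ * genE₁ * genD * genE₂) := by
      rw [h1]
      group

/-- The kernel of the second forgetful map is normal: the conjugation by `e₁`
fixes `s` and `d * p₃⁻¹`, conjugation by `e₂` fixes `s` and `p₃`, and both map `d` to a conjugate of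
`d` in the subgroup. -/
instance normal_fibre : fibre.Normal := by
  rw [← Subgroup.normalizer_eq_top_iff]
  have hle := Subgroup.le_normalizer (H := fibre)
  -- `h` is the product of the loops around the first two of the other punctures.
  obtain ⟨h, hh⟩ : ∃ h, h = genD * genP₃⁻¹ := ⟨_, rfl⟩
  have hmem : h ∈ fibre := hh ▸ mul_mem genD_mem (inv_mem genP₃_mem)
  have hT : h = genT * genE₁⁻¹ := by
    rw [hh, genP₃]
    group
  have hP : genP₃ = h⁻¹ * genD := by
    rw [hh]
    group
  have e1h : Commute genE₁ h := by
    rw [hT]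
    exact commute_genT_genE₁.symm.mul_right (Commute.refl _).inv_right
  have e1d : genE₁ * genD * genE₁⁻¹ = h⁻¹ * genD * h := by
    have : genT⁻¹ * genD * genT = genD := by
      rw [commute_genT_genD.inv_left.eq, inv_mul_cancel_right]
    rw [hT]
    calc genE₁ * genD * genE₁⁻¹ = genE₁ * (genT⁻¹ * genD * genT) * genE₁⁻¹ := by rw [this]
      _ = _ := by group
  have e1d' : genE₁⁻¹ * genD * genE₁ = h * genD * h⁻¹ := by
    have h1 : genE₁⁻¹ * (h * (genE₁ * genD * genE₁⁻¹) * h⁻¹) * genE₁ = genE₁⁻¹ * genD * genE₁ := by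
      rw [e1d]
      group
    rw [← h1]
    calc genE₁⁻¹ * (h * (genE₁ * genD * genE₁⁻¹) * h⁻¹) * genE₁
        = genE₁⁻¹ * (h * genE₁) * genD * (genE₁⁻¹ * h⁻¹) * genE₁ := by group
      _ = h * genD * h⁻¹ := by
        rw [← e1h.eq, (e1h.inv_left.inv_right).eq]
        group
  have k1 : Commute genE₂ (genS * genP₃) := commute_genS_genE₂.symm.mul_right commute_genE₂_genP₃
  have e2d' : genE₂⁻¹ * genD * genE₂ = genS * genP₃ * genD * (genS * genP₃)⁻¹ := by
    have h1 : genE₂⁻¹ * genD * genE₂ = genE₁ * (genS * genD * genS⁻¹) * genE₁⁻¹ := by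
      rw [genS_conj_genD]
      group
    rw [h1]
    calc genE₁ * (genS * genD * genS⁻¹) * genE₁⁻¹
        = (genE₁ * genS) * genD * (genS⁻¹ * genE₁⁻¹) := by group
      _ = genS * (genE₁ * genD * genE₁⁻¹) * genS⁻¹ := by
        rw [← commute_genS_genE₁.eq, (commute_genS_genE₁.inv_left.inv_right).eq]
        group
      _ = _ := by
        rw [e1d, hP]
        group
  have e2d : genE₂ * genD * genE₂⁻¹ = (genS * genP₃)⁻¹ * genD * (genS * genP₃) := by
    obtain ⟨k, hk⟩ : ∃ k, k = genS * genP₃ := ⟨_, rfl⟩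
    rw [← hk] at k1 e2d' ⊢
    have h1 : genE₂ * (k⁻¹ * (genE₂⁻¹ * genD * genE₂) * k) * genE₂⁻¹ = genE₂ * genD * genE₂⁻¹ := by
      rw [e2d']
      group
    rw [← h1]
    calc genE₂ * (k⁻¹ * (genE₂⁻¹ * genD * genE₂) * k) * genE₂⁻¹
        = genE₂ * (k⁻¹ * genE₂⁻¹) * genD * (genE₂ * k) * genE₂⁻¹ := by group
      _ = _ := by
        rw [k1.eq, ← (k1.inv_left.inv_right).eq]
        group
  have mE₁ : genE₁ ∈ Subgroup.normalizer (fibre : Set PureFive) := by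
    have hP₃ : ∀ g : PureFive, g * genP₃ * g⁻¹ = (g * h * g⁻¹)⁻¹ * (g * genD * g⁻¹) := by
      intro g
      rw [hP]
      group
    have m1 : genE₁ * genD * genE₁⁻¹ ∈ fibre := by
      rw [e1d]
      exact mul_mem (mul_mem (inv_mem hmem) genD_mem) hmem
    have m2 : genE₁⁻¹ * genD * genE₁ ∈ fibre := by
      rw [e1d']
      exact mul_mem (mul_mem hmem genD_mem) (inv_mem hmem)
    refine mem_normalizer_fibre ?_ ?_
    · rintro _ (rfl | rfl | rfl)
      · exact m1
      · rw [← commute_genS_genE₁.eq, mul_inv_cancel_right]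
        exact genS_mem
      · rw [hP₃, e1h.eq, mul_inv_cancel_right]
        exact mul_mem (inv_mem hmem) m1
    · rintro _ (rfl | rfl | rfl)
      · exact m2
      · rw [mul_assoc, commute_genS_genE₁.eq, inv_mul_cancel_left]
        exact genS_mem
      · have h1 := hP₃ genE₁⁻¹
        rw [inv_inv, e1h.inv_left.eq, inv_mul_cancel_right] at h1
        rw [h1]
        exact mul_mem (inv_mem hmem) m2
  have mE₂ : genE₂ ∈ Subgroup.normalizer (fibre : Set PureFive) := by
    have hk := mul_mem genS_mem genP₃_mem
    refine mem_normalizer_fibre ?_ ?_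
    · rintro _ (rfl | rfl | rfl)
      · rw [e2d]
        exact mul_mem (mul_mem (inv_mem hk) genD_mem) hk
      · rw [← commute_genS_genE₂.eq, mul_inv_cancel_right]
        exact genS_mem
      · rw [commute_genE₂_genP₃.eq, mul_inv_cancel_right]
        exact genP₃_mem
    · rintro _ (rfl | rfl | rfl)
      · rw [e2d']
        exact mul_mem (mul_mem hk genD_mem) (inv_mem hk)
      · rw [mul_assoc, commute_genS_genE₂.eq, inv_mul_cancel_left]
        exact genS_mem
      · rw [mul_assoc, ← commute_genE₂_genP₃.eq, inv_mul_cancel_left]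
        exact genP₃_mem
  have mT : genT ∈ Subgroup.normalizer (fibre : Set PureFive) := by
    rw [show genT = h * genE₁ by rw [hT, inv_mul_cancel_right]]
    exact mul_mem (hle hmem) mE₁
  rw [eq_top_iff]
  rintro g -
  rw [← SemidirectProduct.inl_left_mul_inr_right g]
  refine mul_mem ?_ ?_
  · have : (FreeGroup.lift fun i => SemidirectProduct.inl (of i)) = (SemidirectProduct.inl :
        FreeGroup (Fin 3) →* PureFive) := ext_hom _ _ fun i => lift_apply_of
    have h2 : (SemidirectProduct.inl : FreeGroup (Fin 3) →* PureFive).range ≤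
        Subgroup.normalizer (fibre : Set PureFive) := by
      rw [← this]
      refine FreeGroup.range_lift_le ?_
      rintro _ ⟨i, rfl⟩
      fin_cases i
      · exact hle genD_mem
      · exact mE₁
      · exact mE₂
    exact h2 ⟨_, rfl⟩
  · have : (FreeGroup.lift fun i => SemidirectProduct.inr (of i)) = (SemidirectProduct.inr :
        F2 →* PureFive) := ext_hom _ _ fun i => lift_apply_of
    have h2 : (SemidirectProduct.inr : F2 →* PureFive).range ≤
        Subgroup.normalizer (fibre : Set PureFive) := by
      rw [← this]
      refine FreeGroup.range_lift_le ?_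
      rintro _ ⟨i, rfl⟩
      fin_cases i
      · exact hle genS_mem
      · exact mT
    exact h2 ⟨_, rfl⟩

/-! ### The mapping class group acting on the free group of rank two -/

/-- The composite of the hyperelliptic involution with the inner automorphism of `f`. -/
def refl (f : F2) : MulAut F2 := MulAut.conj f * iota

theorem iota_mul_conj (g : F2) : iota * MulAut.conj g = MulAut.conj (iota g) * iota :=
  conj_apply_mul iota g

theorem iota_iota (g : F2) : iota (iota g) = g :=
  DFunLike.congr_fun iota_mul_iota g

theorem refl_mul_refl (f g : F2) : refl f * refl g = MulAut.conj (f * iota g) := by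
  rw [refl, refl, mul_assoc, ← mul_assoc iota, iota_mul_conj, mul_assoc _ iota, iota_mul_iota,
    mul_one, map_mul]

theorem conj_mul_refl (f g : F2) : MulAut.conj f * refl g = refl (f * g) := by
  rw [refl, refl, map_mul, mul_assoc]

theorem refl_mul_conj (f g : F2) : refl f * MulAut.conj g = refl (f * iota g) := by
  rw [refl, refl, mul_assoc, iota_mul_conj, map_mul, mul_assoc]

theorem refl_inv (f : F2) : (refl f)⁻¹ = refl (iota f)⁻¹ := by
  rw [inv_eq_iff_mul_eq_one, refl_mul_refl, map_inv, iota_iota, mul_inv_cancel, map_one]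

/-- The value of the homomorphism `toAut` at `d`. -/
def autD : MulAut F2 := refl (of 0 * (of 1)⁻¹)

/-- The value of the homomorphism `toAut` at `s`. -/
def autS : MulAut F2 := refl (of 1 * (of 0)⁻¹)

/-- The value of the homomorphism `toAut` at `e₁`. -/
def autE₁ : MulAut F2 := MulAut.conj ((of 0)⁻¹ * (of 0)⁻¹) * alpha

/-- The value of the homomorphism `toAut` at `e₂`. -/
def autE₂ : MulAut F2 := MulAut.conj ((of 1)⁻¹ * (of 1)⁻¹) * beta

/-- The homomorphism `toAut` on the normal factor. -/
def toAutFibre : FreeGroup (Fin 3) →* MulAut F2 := FreeGroup.lift ![autD, autE₁, autE₂]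

/-- The homomorphism `toAut` on the complement. -/
def toAutBase : F2 →* MulAut F2 := FreeGroup.lift ![autS, alpha]

@[simp] theorem toAutFibre_zero : toAutFibre (of 0) = autD := lift_apply_of
@[simp] theorem toAutFibre_one : toAutFibre (of 1) = autE₁ := lift_apply_of
@[simp] theorem toAutFibre_two : toAutFibre (of 2) = autE₂ := lift_apply_of
@[simp] theorem toAutBase_zero : toAutBase (of 0) = autS := lift_apply_of
@[simp] theorem toAutBase_one : toAutBase (of 1) = alpha := lift_apply_of

theorem autS_mul_autE₁ : autS * autE₁ = autE₁ * autS := by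
  apply mulAut_ext_two <;> simp [MulAut.mul_apply, autS, autE₁, refl, mul_assoc]

theorem autS_mul_autE₂ : autS * autE₂ = autE₂ * autS := by
  apply mulAut_ext_two <;> simp [MulAut.mul_apply, autS, autE₂, refl, mul_assoc]

theorem autE₂_mul_autE₁_mul_autS : autE₂ * autE₁ * autS * autD = autD * autE₂ * autE₁ * autS := by
  apply mulAut_ext_two <;> simp [MulAut.mul_apply, autS, autD, autE₁, autE₂, refl, mul_assoc]

theorem alpha_mul_autD : alpha * autD = autD * alpha := by
  apply mulAut_ext_two <;> simp [MulAut.mul_apply, autD, refl, mul_assoc]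

theorem alpha_mul_autE₁ : alpha * autE₁ = autE₁ * alpha := by
  apply mulAut_ext_two <;> simp [MulAut.mul_apply, autE₁, mul_assoc]

theorem alpha_mul_autE₂ : alpha * autE₂ * alpha⁻¹ * (autE₁ * autD) = autE₁ * autD * autE₂ := by
  have h : alpha⁻¹ * (autE₁ * autD) = MulAut.conj ((of 0)⁻¹ * (of 0)⁻¹) * autD := by
    rw [inv_mul_eq_iff_eq_mul]
    apply mulAut_ext_two <;> simp [MulAut.mul_apply, autD, autE₁, refl, mul_assoc]
  rw [mul_assoc, h]
  apply mulAut_ext_two <;> simp [MulAut.mul_apply, autD, autE₁, autE₂, refl, mul_assoc]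

theorem toAutFibre_actHom (q : F2) : toAutFibre.comp (actHom q).toMonoidHom =
    (MulAut.conj (toAutBase q)).toMonoidHom.comp toAutFibre := by
  have key : ∀ q : F2, (∀ w, toAutFibre (actHom q w) =
      toAutBase q * toAutFibre w * (toAutBase q)⁻¹) := by
    intro q
    induction q using FreeGroup.induction_on with
    | C1 => simp
    | of i =>
      have h : toAutFibre.comp (actHom (of i)).toMonoidHom =
          (MulAut.conj (toAutBase (of i))).toMonoidHom.comp toAutFibre := by
        refine ext_hom _ _ fun j => ?_
        change toAutFibre (actHom (of i) (of j)) =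
          toAutBase (of i) * toAutFibre (of j) * (toAutBase (of i))⁻¹
        fin_cases i <;> fin_cases j
        · simp [actHom, actS]
          rw [eq_mul_inv_iff_mul_eq]
          simp only [mul_assoc]
          rw [inv_mul_eq_iff_eq_mul, inv_mul_eq_iff_eq_mul]
          simp only [← mul_assoc]
          exact autE₂_mul_autE₁_mul_autS.symm
        · simp [actHom, actS, autS_mul_autE₁]
        · simp [actHom, actS, autS_mul_autE₂]
        · simp [actHom, actT, alpha_mul_autD]
        · simp [actHom, actT, alpha_mul_autE₁]
        · simp [actHom, actT]
          rw [mul_inv_eq_iff_eq_mul, mul_inv_eq_iff_eq_mul]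
          have := alpha_mul_autE₂
          simp only [← mul_assoc] at this
          exact this.symm
      exact fun w => DFunLike.congr_fun h w
    | inv_of i ih =>
      intro w
      have h := ih ((actHom (of i))⁻¹ w)
      rw [MulAut.apply_inv_self] at h
      rw [map_inv, map_inv, h]
      group
    | mul a b ha hb =>
      intro w
      rw [map_mul, MulAut.mul_apply, ha, hb, map_mul]
      group
  ext1 i
  exact key q _

/-- The realisation of the pure mapping class group of the sphere with five punctures as a group of
automorphisms of the free group of rank two. -/
def toAut : PureFive →* MulAut F2 :=
  SemidirectProduct.lift toAutFibre toAutBase toAutFibre_actHom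

theorem toAut_genD : toAut genD = autD := by simp [toAut, genD]
theorem toAut_genE₁ : toAut genE₁ = autE₁ := by simp [toAut, genE₁]
theorem toAut_genE₂ : toAut genE₂ = autE₂ := by simp [toAut, genE₂]
theorem toAut_genS : toAut genS = autS := by simp [toAut, genS]
theorem toAut_genT : toAut genT = alpha := by simp [toAut, genT]

theorem toAut_genP₃ : toAut genP₃ = refl ((of 0)⁻¹ * (of 1)⁻¹) := by
  have h : autE₁ * alpha⁻¹ = MulAut.conj ((of 0)⁻¹ * (of 0)⁻¹) := mul_inv_cancel_right _ _
  rw [genP₃, map_mul, map_mul, map_inv, toAut_genE₁, toAut_genT, toAut_genD, h, autD,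
    conj_mul_refl]
  simp [mul_assoc]

theorem toAut_genP₁ : toAut genP₁ = refl (of 0 * of 1) := by
  rw [genP₁, map_mul, map_mul, map_inv, map_inv, toAut_genP₃, toAut_genD, toAut_genS, autD, autS,
    refl_inv, refl_inv, refl_mul_refl, conj_mul_refl]
  simp [mul_assoc]

/-- The homomorphism from a free group of rank three to the automorphism group whose image is the
image of `fibre`. -/
def fibreHom : FreeGroup (Fin 3) →* MulAut F2 :=
  FreeGroup.lift ![refl (of 0 * (of 1)⁻¹), refl (of 0 * of 1), refl ((of 0)⁻¹ * (of 1)⁻¹)]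

@[simp] theorem fibreHom_zero : fibreHom (of 0) = refl (of 0 * (of 1)⁻¹) := lift_apply_of
@[simp] theorem fibreHom_one : fibreHom (of 1) = refl (of 0 * of 1) := lift_apply_of
@[simp] theorem fibreHom_two : fibreHom (of 2) = refl ((of 0)⁻¹ * (of 1)⁻¹) := lift_apply_of

theorem toAut_comp_lift :
    toAut.comp (FreeGroup.lift ![genD, genP₁, genP₃]) = fibreHom := by
  refine ext_hom _ _ fun i => ?_
  fin_cases i
  · simp [toAut_genD, autD]
  · simp [toAut_genP₁]
  · simp [toAut_genP₃]

theorem map_fibre : fibre.map toAut = fibreHom.range := by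
  rw [fibre_eq_range, MonoidHom.map_range, toAut_comp_lift]

/-! ### Congruence subgroups in the image -/

theorem refl_mul_refl_mul_inv (f g : F2) :
    refl g * refl f * (refl g)⁻¹ = refl (g * iota f * (iota g)⁻¹) := by
  rw [refl_mul_refl, refl_inv, conj_mul_refl]

theorem refl_D_mem : refl (of 0 * (of 1)⁻¹) ∈ fibreHom.range := ⟨of 0, lift_apply_of⟩

theorem refl_P₁_mem : refl (of 0 * of 1) ∈ fibreHom.range := ⟨of 1, lift_apply_of⟩

theorem refl_P₃_mem : refl ((of 0)⁻¹ * (of 1)⁻¹) ∈ fibreHom.range := ⟨of 2, lift_apply_of⟩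

theorem refl_mem_normalizer {g : F2} (hg : iota g = g⁻¹)
    (hD : refl (g * iota (of 0 * (of 1)⁻¹) * g) ∈ fibreHom.range)
    (h₁ : refl (g * iota (of 0 * of 1) * g) ∈ fibreHom.range)
    (h₃ : refl (g * iota ((of 0)⁻¹ * (of 1)⁻¹) * g) ∈ fibreHom.range) :
    refl g ∈ Subgroup.normalizer (fibreHom.range : Set (MulAut F2)) := by
  refine Subgroup.mem_normalizer_of_pow_eq_one (n := 1) ?_ ?_
  · rw [pow_two, refl_mul_refl, hg, mul_inv_cancel, map_one]
  · have : fibreHom.range ≤ fibreHom.range.comap (MulAut.conj (refl g)).toMonoidHom := by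
      refine FreeGroup.range_lift_le ?_
      rintro _ ⟨i, rfl⟩
      have key : ∀ f, refl (g * iota f * g) ∈ fibreHom.range →
          refl g * refl f * (refl g)⁻¹ ∈ fibreHom.range := by
        intro f hf
        rwa [refl_mul_refl_mul_inv, hg, inv_inv]
      fin_cases i
      · exact key _ hD
      · exact key _ h₁
      · exact key _ h₃
    exact this

theorem refl_mul_comm_mem : refl (of 1 * of 0) ∈ fibreHom.range := by
  have h : (refl (of 0 * of 1))⁻¹ = refl (of 1 * of 0) := by
    rw [refl_inv]
    simp
  rw [← h]
  exact inv_mem refl_P₁_mem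

theorem refl_inv_D_mem : refl ((of 1)⁻¹ * of 0) ∈ fibreHom.range := by
  have h : (refl (of 0 * (of 1)⁻¹))⁻¹ = refl ((of 1)⁻¹ * of 0) := by
    rw [refl_inv]
    simp
  rw [← h]
  exact inv_mem refl_D_mem

theorem refl_inv_P₃_mem : refl ((of 1)⁻¹ * (of 0)⁻¹) ∈ fibreHom.range := by
  have h : (refl ((of 0)⁻¹ * (of 1)⁻¹))⁻¹ = refl ((of 1)⁻¹ * (of 0)⁻¹) := by
    rw [refl_inv]
    simp
  rw [← h]
  exact inv_mem refl_P₃_mem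

theorem conj_zero_sq_mem : MulAut.conj (of 0 * of 0) ∈ fibreHom.range := by
  have h : refl (of 0 * (of 1)⁻¹) * refl ((of 1)⁻¹ * (of 0)⁻¹) = MulAut.conj (of 0 * of 0) := by
    rw [refl_mul_refl]
    simp [mul_assoc]
  rw [← h]
  exact mul_mem refl_D_mem refl_inv_P₃_mem

theorem conj_one_sq_mem : MulAut.conj (of 1 * of 1) ∈ fibreHom.range := by
  have h : refl (of 1 * of 0) * refl (of 0 * (of 1)⁻¹) = MulAut.conj (of 1 * of 1) := by
    rw [refl_mul_refl]
    simp [mul_assoc]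
  rw [← h]
  exact mul_mem refl_mul_comm_mem refl_D_mem

theorem conj_commutator_mem :
    MulAut.conj (of 0 * (of 1)⁻¹ * ((of 0)⁻¹ * of 1)) ∈ fibreHom.range := by
  have h : refl (of 0 * (of 1)⁻¹) * refl (of 0 * (of 1)⁻¹) =
      MulAut.conj (of 0 * (of 1)⁻¹ * ((of 0)⁻¹ * of 1)) := by
    rw [refl_mul_refl]
    simp
  rw [← h]
  exact mul_mem refl_D_mem refl_D_mem

/-- The free group of rank two normalises the image of the fibre: so do the three involutions
`refl (of 0)`, `refl 1` and `refl (of 1)⁻¹`, whose products are the generators `x` and `y`. -/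
theorem conj_mem_normalizer (g : F2) :
    MulAut.conj g ∈ Subgroup.normalizer (fibreHom.range : Set (MulAut F2)) := by
  have ha : refl (of 0) ∈ Subgroup.normalizer (fibreHom.range : Set (MulAut F2)) := by
    refine refl_mem_normalizer iota_zero ?_ ?_ ?_
    · simpa using refl_mul_comm_mem
    · simpa using refl_inv_D_mem
    · have := mul_mem conj_zero_sq_mem refl_mul_comm_mem
      rw [conj_mul_refl] at this
      simpa [mul_assoc] using this
  have hb : refl 1 ∈ Subgroup.normalizer (fibreHom.range : Set (MulAut F2)) := by
    refine refl_mem_normalizer (by simp) ?_ ?_ ?_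
    · have := mul_mem (mul_mem refl_P₃_mem refl_inv_D_mem) refl_P₁_mem
      rw [refl_mul_refl, conj_mul_refl] at this
      simpa [mul_assoc] using this
    · simpa using refl_P₃_mem
    · simpa using refl_P₁_mem
  have hc : refl (of 1)⁻¹ ∈ Subgroup.normalizer (fibreHom.range : Set (MulAut F2)) := by
    refine refl_mem_normalizer (by simp) ?_ ?_ ?_
    · simpa [mul_assoc] using refl_inv_P₃_mem
    · have := mul_mem refl_inv_P₃_mem conj_one_sq_mem
      rw [refl_mul_conj] at this
      simpa [mul_assoc] using this
    · simpa [mul_assoc] using refl_inv_D_mem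
  have h : (Subgroup.normalizer (fibreHom.range : Set (MulAut F2))).comap MulAut.conj = ⊤ := by
    rw [eq_top_iff, ← FreeGroup.closure_range_of, Subgroup.closure_le]
    rintro _ ⟨i, rfl⟩
    fin_cases i
    · have := mul_mem ha hb
      rwa [refl_mul_refl, map_one, mul_one] at this
    · have := mul_mem hb hc
      rw [refl_mul_refl] at this
      simpa using this
  have h2 : g ∈ (Subgroup.normalizer (fibreHom.range : Set (MulAut F2))).comap MulAut.conj :=
    h ▸ Subgroup.mem_top g
  exact h2

/-- The subgroup of the free group of rank two that corresponds to the intersection of the fibre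
with the group of inner automorphisms. -/
def innerFibre : Subgroup F2 := fibreHom.range.comap MulAut.conj

instance normal_innerFibre : innerFibre.Normal := by
  constructor
  intro f hf g
  have := (Subgroup.mem_normalizer_iff.1 (conj_mem_normalizer g) (MulAut.conj f)).1 hf
  rw [← map_inv, ← map_mul, ← map_mul] at this
  exact this

/-- The abelianisation of the free group of rank two, modulo two. -/
def abMod2 : F2 →* Multiplicative (Fin 2 → ZMod 2) :=
  FreeGroup.lift fun j => Multiplicative.ofAdd (Pi.single j 1)

/-- The quotient by `innerFibre` is generated by two commuting involutions. -/
theorem ker_abMod2_le : abMod2.ker ≤ innerFibre := by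
  let q := QuotientGroup.mk' innerFibre
  have hq : ∀ f ∈ innerFibre, q f = 1 := fun f hf => (QuotientGroup.eq_one_iff f).2 hf
  have hx : q (of 0) ^ 2 = 1 := by
    rw [pow_two, ← map_mul]
    exact hq _ conj_zero_sq_mem
  have hy : q (of 1) ^ 2 = 1 := by
    rw [pow_two, ← map_mul]
    exact hq _ conj_one_sq_mem
  have hxy : Commute (q (of 0)) (q (of 1)) := by
    have h1 := hq _ conj_commutator_mem
    have hx' : (q (of 0))⁻¹ = q (of 0) := inv_eq_of_mul_eq_one_right (by rw [← pow_two, hx])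
    have hy' : (q (of 1))⁻¹ = q (of 1) := inv_eq_of_mul_eq_one_right (by rw [← pow_two, hy])
    rw [map_mul, map_mul, map_mul, map_inv, map_inv, hx', hy', mul_eq_one_iff_eq_inv, mul_inv_rev,
      hx', hy'] at h1
    exact h1
  have key : ∀ f : F2, ∃ i j : ℕ, q f = q (of 0) ^ i * q (of 1) ^ j ∧
      (abMod2 f).toAdd = ![(i : ZMod 2), (j : ZMod 2)] := by
    intro f
    induction f using FreeGroup.induction_on with
    | C1 => exact ⟨0, 0, by simp, by ext k; fin_cases k <;> simp⟩
    | of k =>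
      fin_cases k
      · exact ⟨1, 0, by simp, by ext k; fin_cases k <;> simp [abMod2]⟩
      · exact ⟨0, 1, by simp, by ext k; fin_cases k <;> simp [abMod2]⟩
    | inv_of k ih =>
      obtain ⟨i, j, h1, h2⟩ := ih
      refine ⟨i, j, ?_, ?_⟩
      · rw [map_inv, h1, inv_eq_iff_mul_eq_one, mul_assoc, ← mul_assoc (q (of 1) ^ j),
          ← (hxy.pow_pow i j).eq, mul_assoc, ← mul_assoc, ← pow_add, ← pow_add, ← two_mul,
          ← two_mul, pow_mul, pow_mul, hx, hy, one_pow, one_pow, mul_one]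
      · rw [map_inv, toAdd_inv, h2]
        ext k
        exact ZModModule.neg_eq_self _
    | mul f g hf hg =>
      obtain ⟨i, j, h1, h2⟩ := hf
      obtain ⟨i', j', h1', h2'⟩ := hg
      refine ⟨i + i', j + j', ?_, ?_⟩
      · rw [map_mul, h1, h1', mul_assoc, ← mul_assoc (q (of 1) ^ j), ← (hxy.pow_pow i' j).eq,
          mul_assoc, ← mul_assoc, ← pow_add, ← pow_add]
      · rw [map_mul, toAdd_mul, h2, h2']
        ext k
        fin_cases k <;> simp
  intro f hf
  obtain ⟨i, j, h1, h2⟩ := key f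
  rw [MonoidHom.mem_ker.1 hf, toAdd_one] at h2
  have hi := (ZMod.natCast_eq_zero_iff i 2).1 (congrFun h2 0).symm
  have hj := (ZMod.natCast_eq_zero_iff j 2).1 (congrFun h2 1).symm
  obtain ⟨i, rfl⟩ := hi
  obtain ⟨j, rfl⟩ := hj
  rw [pow_mul, pow_mul, hx, hy, one_pow, one_pow, one_mul] at h1
  exact (QuotientGroup.eq_one_iff f).1 h1

instance finiteIndex_innerFibre : innerFibre.FiniteIndex :=
  have : Finite (Multiplicative (Fin 2 → ZMod 2)) := inferInstanceAs (Finite (Fin 2 → ZMod 2))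
  have := Subgroup.finiteIndex_ker abMod2
  Subgroup.finiteIndex_of_le ker_abMod2_le

theorem Phi_le_range_toAut : Phi ≤ toAut.range := by
  refine (Subgroup.closure_le _).2 ?_
  have h : fibreHom.range ≤ toAut.range := by
    rw [← map_fibre]
    exact Subgroup.map_le_range _ _
  rintro _ (rfl | rfl)
  · exact ⟨genT, toAut_genT⟩
  · have h1 := mul_mem (h conj_one_sq_mem) ⟨genE₂, toAut_genE₂⟩
    rw [autE₂, ← mul_assoc, ← map_mul] at h1
    simpa [mul_assoc] using h1

/-- The marking of the free group of rank two by a wreath product in which the centraliser of the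
commutator of the generators lies over the kernel of the reduction modulo two. -/
noncomputable def markingHom :
    F2 →* Multiplicative (ZMod 3) ≀ᵣ Multiplicative (Fin 2 → ZMod 2) :=
  FreeGroup.lift ![RegularWreathProduct.single (Multiplicative.ofAdd 1) (abMod2 (of 0)),
    RegularWreathProduct.inl (abMod2 (of 1))]

theorem right_markingHom (f : F2) : (markingHom f).right = abMod2 f := by
  have : (RegularWreathProduct.rightHom).comp markingHom = abMod2 := by
    refine ext_hom _ _ fun i => ?_
    fin_cases i
    · simp [markingHom, RegularWreathProduct.single]
    · simp [markingHom]
  exact DFunLike.congr_fun this f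

theorem mem_ker_abMod2_of_commute {f : F2}
    (h : Commute (markingHom f) (markingHom (of 0 * (of 1)⁻¹ * ((of 0)⁻¹ * of 1)))) :
    f ∈ abMod2.ker := by
  classical
  set c := markingHom (of 0 * (of 1)⁻¹ * ((of 0)⁻¹ * of 1)) with hc
  have h1 : c.right = 1 := by
    rw [hc, right_markingHom, map_mul, map_mul, map_mul, map_inv, map_inv, mul_comm (abMod2 (of 0))]
    group
  have h2 := congrFun (congrArg RegularWreathProduct.left h.eq) (abMod2 f)
  rw [RegularWreathProduct.mul_left, RegularWreathProduct.mul_left, Pi.mul_apply, Pi.mul_apply, h1,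
    inv_one, one_mul, right_markingHom, inv_mul_cancel, mul_comm] at h2
  have h3 : c.left 1 = c.left (abMod2 f) := mul_right_cancel h2
  let δ : Multiplicative (Fin 2 → ZMod 2) → Multiplicative (ZMod 3) :=
    Pi.mulSingle 1 (Multiplicative.ofAdd 1)
  -- The base component of `c` takes the values `1` and `-1` at two points and vanishes elsewhere.
  have h4 : ∀ v, c.left v = δ v * (δ (abMod2 (of 1) * v))⁻¹ := by
    intro v
    rw [hc]
    simp only [map_mul, map_inv, RegularWreathProduct.mul_left, RegularWreathProduct.mul_right,
      RegularWreathProduct.inv_left, RegularWreathProduct.inv_right, Pi.mul_apply, Pi.inv_apply,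
      right_markingHom]
    simp [markingHom, RegularWreathProduct.single]
    have h5 : abMod2 (of 0) * (abMod2 (of 1) * (abMod2 (of 0))⁻¹ * v) = abMod2 (of 1) * v := by
      rw [mul_comm (abMod2 (of 1)), ← mul_assoc, mul_inv_cancel_left]
    rw [h5]
    simp only [δ, Pi.mulSingle_apply]
    congr!
  have hq : abMod2 (of 1) ≠ 1 := by
    simp only [abMod2, lift_apply_of]
    decide
  rw [h4, h4] at h3
  by_contra hf
  rw [MonoidHom.mem_ker] at hf
  simp only [δ] at h3
  rw [mul_one, Pi.mulSingle_eq_same, Pi.mulSingle_eq_of_ne hq, Pi.mulSingle_eq_of_ne hf,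
    Pi.mulSingle_apply] at h3
  revert h3
  split_ifs <;> decide

theorem map_Phi_commutator {φ : MulAut F2} (hφ : φ ∈ Phi) :
    φ (of 0 * (of 1)⁻¹ * ((of 0)⁻¹ * of 1)) = of 0 * (of 1)⁻¹ * ((of 0)⁻¹ * of 1) := by
  have : Phi ≤ MulAction.stabilizer (MulAut F2) (of 0 * (of 1)⁻¹ * ((of 0)⁻¹ * of 1) : F2) := by
    refine (Subgroup.closure_le _).2 ?_
    rintro _ (rfl | rfl) <;> rw [SetLike.mem_coe, MulAction.mem_stabilizer_iff] <;>
      simp [mul_assoc]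
  exact this hφ

/-- The image of the five-punctured mapping class group contains a congruence subgroup: an
automorphism in a deep one has the form `conj f * φ` with `φ ∈ Phi`, and since `φ` fixes the
commutator of the generators, `f` commutes with it modulo the kernel of `markingHom`. -/
theorem exists_congruence_le_range : ∃ K : Subgroup F2, K.Normal ∧ K.FiniteIndex ∧
    ∀ σ : MulAut F2, (∀ g, σ g * g⁻¹ ∈ K) → σ ∈ toAut.range := by
  have : Finite (Multiplicative (Fin 2 → ZMod 2)) := inferInstanceAs (Finite (Fin 2 → ZMod 2))
  have : Finite (Multiplicative (Fin 2 → ZMod 4)) := inferInstanceAs (Finite (Fin 2 → ZMod 4))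
  have : Finite (Multiplicative (ZMod 3)) := inferInstanceAs (Finite (ZMod 3))
  have := Subgroup.finiteIndex_ker abMod4
  have := Subgroup.finiteIndex_ker markingHom
  refine ⟨abMod4.ker ⊓ markingHom.ker, inferInstance, inferInstance, fun σ hσ => ?_⟩
  have hM : matrixMod4Hom σ = 1 := by
    rw [← matrixMod4_one]
    ext i j
    have h1 := (Subgroup.mem_inf.1 (hσ (of j))).1
    rw [MonoidHom.mem_ker, map_mul, map_inv, mul_inv_eq_one] at h1
    change (abMod4 (σ (of j))).toAdd i = (abMod4 (of j)).toAdd i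
    rw [h1]
  obtain ⟨f, φ, hφ, rfl⟩ := exists_eq_conj_mul_of_matrixMod4Hom_eq_one hM
  refine mul_mem ?_ (Phi_le_range_toAut hφ)
  have h2 := (Subgroup.mem_inf.1 (hσ (of 0 * (of 1)⁻¹ * ((of 0)⁻¹ * of 1)))).2
  rw [MulAut.mul_apply, map_Phi_commutator hφ, MulAut.conj_apply, MonoidHom.mem_ker,
    ← commutatorElement_def, map_commutatorElement,
    commutatorElement_eq_one_iff_commute] at h2
  have h3 : MulAut.conj f ∈ fibreHom.range := ker_abMod2_le (mem_ker_abMod2_of_commute h2)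
  rw [← map_fibre] at h3
  exact Subgroup.map_le_range _ _ h3

/-! ### Freeness of the fibre -/

/-- An element of a free group of rank two that commutes with both basis elements is trivial: it
would commute with the basis element different from its first letter. -/
theorem eq_one_of_conj_eq_one {f : F2} (hf : MulAut.conj f = 1) : f = 1 := by
  by_contra hne
  have hcomm : ∀ w, f * w = w * f := by
    intro w
    have := DFunLike.congr_fun hf w
    rwa [MulAut.conj_apply, MulAut.one_apply, mul_inv_eq_iff_eq_mul] at this
  obtain ⟨l, L, hL⟩ := List.exists_cons_of_ne_nil (mt toWord_eq_nil_iff.1 hne)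
  obtain ⟨i, hi⟩ : ∃ i, i ≠ l.1 := exists_ne l.1
  have h1 : gromov (of i) f = 0 := by
    unfold gromov
    rw [hL, toWord_of]
    simp only [List.commonPrefixLength, if_neg fun h : (i, true) = l => hi (congrArg Prod.fst h)]
  have h2 : gromov (of i)⁻¹ f = 0 := by
    unfold gromov
    rw [hL, toWord_inv, toWord_of]
    simp only [invRev, List.map_cons, List.map_nil, List.reverse_singleton,
      List.commonPrefixLength]
    rw [if_neg fun h : (i, !true) = l => hi (congrArg Prod.fst h)]
  have h3 := norm_mul (of i) f
  have h4 := norm_inv_mul f (f * of i)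
  have h5 := norm_inv_mul (of i) (of i * f)
  have h6 := min_gromov_le (of i) (of i * f) f
  have h7 : norm f ≠ 0 := mt norm_eq_zero.1 hne
  rw [inv_mul_cancel_left, norm_of, hcomm] at h4
  rw [inv_mul_cancel_left, norm_of] at h5
  rw [norm_of] at h3
  rw [gromov_comm (of i * f) f] at h6
  omega

/-- The involutions `refl (of 0)`, `refl 1`, `refl (of 1)⁻¹` generate a free product of three groups
of order two, which contains the image of the fibre with index four. The functions `coverA`,
`coverB`, `coverC` give the action of the three involutions on this free product by left
multiplication, when the four cosets are identified with copies of the free group on the images of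
`d`, `p₁`, `p₃`. -/
def coverA : Fin 4 × FreeGroup (Fin 3) → Fin 4 × FreeGroup (Fin 3)
  | (0, w) => (1, w)
  | (1, w) => (0, w)
  | (2, w) => (3, (of 2)⁻¹ * w)
  | (3, w) => (2, of 2 * w)

/-- The action of `refl 1`; see `coverA`. -/
def coverB : Fin 4 × FreeGroup (Fin 3) → Fin 4 × FreeGroup (Fin 3)
  | (0, w) => (2, w)
  | (2, w) => (0, w)
  | (1, w) => (3, (of 0)⁻¹ * w)
  | (3, w) => (1, of 0 * w)

/-- The action of `refl (of 1)⁻¹`; see `coverA`. -/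
def coverC : Fin 4 × FreeGroup (Fin 3) → Fin 4 × FreeGroup (Fin 3)
  | (0, w) => (3, w)
  | (3, w) => (0, w)
  | (1, w) => (2, (of 1)⁻¹ * w)
  | (2, w) => (1, of 1 * w)

theorem coverA_involutive : Function.Involutive coverA := by
  rintro ⟨i, w⟩
  fin_cases i <;> simp [coverA]

theorem coverB_involutive : Function.Involutive coverB := by
  rintro ⟨i, w⟩
  fin_cases i <;> simp [coverB]

theorem coverC_involutive : Function.Involutive coverC := by
  rintro ⟨i, w⟩
  fin_cases i <;> simp [coverC]

/-- The permutation `coverA`. -/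
def permA : Equiv.Perm (Fin 4 × FreeGroup (Fin 3)) := coverA_involutive.toPerm

/-- The permutation `coverB`. -/
def permB : Equiv.Perm (Fin 4 × FreeGroup (Fin 3)) := coverB_involutive.toPerm

/-- The permutation `coverC`. -/
def permC : Equiv.Perm (Fin 4 × FreeGroup (Fin 3)) := coverC_involutive.toPerm

theorem permA_mul_self : permA * permA = 1 := Equiv.ext coverA_involutive

theorem permB_mul_self : permB * permB = 1 := Equiv.ext coverB_involutive

theorem permC_mul_self : permC * permC = 1 := Equiv.ext coverC_involutive

/-- The action of the inner automorphisms on the four cosets; see `coverA`. -/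
def permHom : F2 →* Equiv.Perm (Fin 4 × FreeGroup (Fin 3)) :=
  FreeGroup.lift ![permA * permB, permB * permC]

/-- The action of the free group on `d`, `p₁`, `p₃` on the four cosets; see `coverA`. -/
def fibrePermHom : FreeGroup (Fin 3) →* Equiv.Perm (Fin 4 × FreeGroup (Fin 3)) :=
  FreeGroup.lift ![permA * permB * permC, permA * permC * permB, permB * permA * permC]

theorem permHom_iota (f : F2) : permB * permHom f * permB = permHom (iota f) := by
  have hA : permA⁻¹ = permA := inv_eq_of_mul_eq_one_right permA_mul_self
  have hB : permB⁻¹ = permB := inv_eq_of_mul_eq_one_right permB_mul_self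
  have hC : permC⁻¹ = permC := inv_eq_of_mul_eq_one_right permC_mul_self
  have : (MulAut.conj permB).toMonoidHom.comp permHom = permHom.comp iota.toMonoidHom := by
    refine ext_hom _ _ fun i => ?_
    change permB * permHom (of i) * permB⁻¹ = permHom (iota (of i))
    fin_cases i
    · simp [permHom, hA, hB, mul_assoc, permB_mul_self]
    · simp [permHom, hB, hC, ← mul_assoc, permB_mul_self]
  have h := DFunLike.congr_fun this f
  change permB * permHom f * permB⁻¹ = _ at h
  rwa [hB] at h

/-- The fibre acts on the four cosets through its image in the automorphism group: that image
lies in the group generated by the inner automorphisms and the hyperelliptic involution, which is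
the free product of three groups of order two. -/
theorem fibreHom_compatible (w : FreeGroup (Fin 3)) : ∃ f : F2,
    (fibreHom w = MulAut.conj f ∧ fibrePermHom w = permHom f) ∨
    (fibreHom w = refl f ∧ fibrePermHom w = permHom f * permB) := by
  have hA : permA⁻¹ = permA := inv_eq_of_mul_eq_one_right permA_mul_self
  have hB : permB⁻¹ = permB := inv_eq_of_mul_eq_one_right permB_mul_self
  have hC : permC⁻¹ = permC := inv_eq_of_mul_eq_one_right permC_mul_self
  have hBA : ∀ p, permB * (permB * p) = p := fun p => by rw [← mul_assoc, permB_mul_self, one_mul]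
  induction w using FreeGroup.induction_on with
  | C1 => exact ⟨1, Or.inl ⟨by simp, by simp⟩⟩
  | of k =>
    fin_cases k
    · exact ⟨_, Or.inr ⟨fibreHom_zero, by
        simp [fibrePermHom, permHom, hB, hC, mul_assoc, permB_mul_self]⟩⟩
    · exact ⟨_, Or.inr ⟨fibreHom_one, by
        simp [fibrePermHom, permHom, mul_assoc, hBA]⟩⟩
    · exact ⟨_, Or.inr ⟨fibreHom_two, by
        simp [fibrePermHom, permHom, hA, hB, hC, mul_assoc, permB_mul_self]⟩⟩
  | inv_of k ih =>
    obtain ⟨f, ⟨h1, h2⟩ | ⟨h1, h2⟩⟩ := ih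
    · exact ⟨f⁻¹, Or.inl ⟨by rw [map_inv, h1, map_inv], by rw [map_inv, h2, map_inv]⟩⟩
    · refine ⟨(iota f)⁻¹, Or.inr ⟨by rw [map_inv, h1, refl_inv], ?_⟩⟩
      rw [map_inv, h2, mul_inv_rev, hB, map_inv, ← permHom_iota, mul_inv_rev, mul_inv_rev, hB]
      simp only [mul_assoc, permB_mul_self, mul_one]
  | mul v w hv hw =>
    obtain ⟨f, ⟨h1, h2⟩ | ⟨h1, h2⟩⟩ := hv <;> obtain ⟨g, ⟨h3, h4⟩ | ⟨h3, h4⟩⟩ := hw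
    · exact ⟨f * g, Or.inl ⟨by rw [map_mul, h1, h3, map_mul], by rw [map_mul, h2, h4, map_mul]⟩⟩
    · exact ⟨f * g, Or.inr ⟨by rw [map_mul, h1, h3, conj_mul_refl],
        by rw [map_mul, h2, h4, map_mul, mul_assoc]⟩⟩
    · refine ⟨f * iota g, Or.inr ⟨by rw [map_mul, h1, h3, refl_mul_conj], ?_⟩⟩
      rw [map_mul, h2, h4, map_mul, ← permHom_iota]
      simp only [mul_assoc, permB_mul_self, mul_one]
    · refine ⟨f * iota g, Or.inl ⟨by rw [map_mul, h1, h3, refl_mul_refl], ?_⟩⟩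
      rw [map_mul, h2, h4, map_mul, ← permHom_iota]
      simp only [mul_assoc]

theorem fibrePermHom_apply_zero (w u : FreeGroup (Fin 3)) :
    fibrePermHom w (0, u) = (0, w * u) := by
  induction w using FreeGroup.induction_on generalizing u with
  | C1 => simp
  | of k =>
    fin_cases k <;>
      simp [fibrePermHom, permA, permB, permC, Equiv.Perm.mul_apply, coverA, coverB, coverC]
  | inv_of k ih =>
    rw [map_inv, Equiv.Perm.inv_eq_iff_eq, ih, mul_inv_cancel_left]
  | mul v w hv hw => rw [map_mul, Equiv.Perm.mul_apply, hw, hv, mul_assoc]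

theorem fibreHom_injective : Function.Injective fibreHom := by
  rw [injective_iff_map_eq_one]
  intro w hw
  obtain ⟨f, ⟨h1, h2⟩ | ⟨h1, h2⟩⟩ := fibreHom_compatible w
  · rw [hw] at h1
    rw [eq_one_of_conj_eq_one h1.symm, map_one] at h2
    have h3 := fibrePermHom_apply_zero w 1
    rw [h2, Equiv.Perm.one_apply, mul_one] at h3
    exact (Prod.mk.inj h3).2.symm
  · have h3 := congrArg matrixMod4Hom h1
    rw [hw, refl, map_mul, matrixMod4Hom_conj, matrixMod4Hom_iota, map_one, one_mul] at h3
    exact absurd h3 (by decide)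

theorem toAut_injOn_fibre : Set.InjOn toAut fibre := by
  rw [fibre_eq_range]
  rintro _ ⟨v, rfl⟩ _ ⟨w, rfl⟩ h
  rw [← MonoidHom.comp_apply, ← MonoidHom.comp_apply, toAut_comp_lift] at h
  rw [fibreHom_injective h]

end AutF2

/-! ### The congruence subgroup property -/

instance Subgroup.finiteIndex_comap {G G' : Type*} [Group G] [Group G'] (f : G →* G')
    (H : Subgroup G') [H.FiniteIndex] : (H.comap f).FiniteIndex :=
  ⟨by
    rw [Subgroup.index_comap]
    exact (inferInstance : (H.subgroupOf f.range).FiniteIndex).index_ne_zero⟩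

namespace SemidirectProduct

variable {N G : Type*} [Group N] [Group G] {φ : G →* MulAut N}

/-- The product of a characteristic subgroup of the kernel with the complement. -/
def comapLeft (φ : G →* MulAut N) (M : Subgroup N) [hM : M.Characteristic] :
    Subgroup (N ⋊[φ] G) where
  carrier := {x | x.left ∈ M}
  one_mem' := M.one_mem
  mul_mem' {x _} hx hy :=
    M.mul_mem hx ((Subgroup.characteristic_iff_le_comap.1 hM (φ x.right)) hy)
  inv_mem' {x} hx := (Subgroup.characteristic_iff_le_comap.1 hM (φ x.right⁻¹)) (M.inv_mem hx)

instance finiteIndex_comapLeft (M : Subgroup N) [hM : M.Characteristic] [M.FiniteIndex] :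
    (comapLeft φ M).FiniteIndex := by
  have hiff : ∀ x y : N ⋊[φ] G, x⁻¹ * y ∈ comapLeft φ M ↔ x.left⁻¹ * y.left ∈ M := by
    intro x y
    change (φ x.right⁻¹) x.left⁻¹ * (φ x.right⁻¹) y.left ∈ M ↔ _
    rw [← map_mul]
    exact SetLike.ext_iff.1 (hM.fixed (φ x.right⁻¹)) _
  have : Finite ((N ⋊[φ] G) ⧸ comapLeft φ M) := by
    refine Finite.of_injective (β := N ⧸ M)
      (Quotient.map' (fun x => x.left) fun x y h => ?_) fun x y h => ?_
    · rw [QuotientGroup.leftRel_apply] at h ⊢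
      exact (hiff x y).1 h
    · induction x using QuotientGroup.induction_on with | H x =>
      induction y using QuotientGroup.induction_on with | H y =>
      exact QuotientGroup.eq.2 ((hiff x y).2 (QuotientGroup.eq.1 h))
  exact Subgroup.finiteIndex_of_finite_quotient

end SemidirectProduct

namespace AutF2

/-- The squares of `d`, `s` and of one conjugate of each have trivial common centraliser in
`PureFive`, in the residual form of `exists_characteristic_centralizer_le`, which is applied in both
factors of the semidirect product. -/
theorem exists_finiteIndex_centralizer_le (N : Subgroup PureFive) [N.Normal] [N.FiniteIndex] :
    ∃ L : Subgroup PureFive, L.FiniteIndex ∧ ∀ g : PureFive,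
      (∀ p ∈ ({genD ^ 2, genE₁ * genD ^ 2 * genE₁⁻¹, genS ^ 2, genT * genS ^ 2 * genT⁻¹} :
        Set PureFive), ⁅g, p⁆ ∈ L) → g ∈ N := by
  obtain ⟨M, hMc, hMf, hM⟩ := exists_characteristic_centralizer_le (show (1 : Fin 3) ≠ 0 by decide)
    (N.comap (SemidirectProduct.inl : _ →* PureFive))
  let N₁ := (N ⊓ SemidirectProduct.comapLeft actHom M).normalCore
  have hN₁ : N₁ ≤ N := (Subgroup.normalCore_le _).trans inf_le_left
  have hN₁M : ∀ b : FreeGroup (Fin 3), (SemidirectProduct.inl b : PureFive) ∈ N₁ → b ∈ M :=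
    fun b hb => (Subgroup.mem_inf.1 (Subgroup.normalCore_le _ hb)).2
  have hsurj : Function.Surjective (SemidirectProduct.rightHom : PureFive →* F2) :=
    SemidirectProduct.rightHom_surjective
  have : (N₁.map (SemidirectProduct.rightHom : PureFive →* F2)).Normal :=
    Subgroup.Normal.map inferInstance _ hsurj
  have : (N₁.map (SemidirectProduct.rightHom : PureFive →* F2)).FiniteIndex :=
    ⟨ne_zero_of_dvd_ne_zero Subgroup.FiniteIndex.index_ne_zero
      (Subgroup.index_map_dvd N₁ hsurj)⟩
  obtain ⟨R, hRc, hRf, hR⟩ := exists_characteristic_centralizer_le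
    (show (1 : Fin 2) ≠ 0 by decide) (N₁.map (SemidirectProduct.rightHom : PureFive →* F2))
  refine ⟨N₁ ⊓ R.comap SemidirectProduct.rightHom, inferInstance, fun g hg => ?_⟩
  simp only [Set.mem_insert_iff, Set.mem_singleton_iff, forall_eq_or_imp, forall_eq] at hg
  obtain ⟨h1, h2, h3, h4⟩ := hg
  obtain ⟨n, hn, hng⟩ := hR (SemidirectProduct.rightHom g)
    (by simpa [genS, -SemidirectProduct.rightHom_eq_right] using (Subgroup.mem_inf.1 h3).2)
    (by simpa [genS, genT, -SemidirectProduct.rightHom_eq_right] using (Subgroup.mem_inf.1 h4).2)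
  -- Modulo `N₁`, the element `g` is now the image of an element `b` of the kernel.
  obtain ⟨b, hb⟩ : ∃ b, (SemidirectProduct.inl b : PureFive) = g * n⁻¹ := by
    rw [← MonoidHom.mem_range, SemidirectProduct.range_inl_eq_ker_rightHom, MonoidHom.mem_ker,
      map_mul, map_inv, hng, mul_inv_cancel]
  have hcomm : ∀ c : FreeGroup (Fin 3), ⁅g, (SemidirectProduct.inl c : PureFive)⁆ ∈ N₁ →
      ⁅b, c⁆ ∈ M := by
    intro c hc
    apply hN₁M
    rw [map_commutatorElement, hb, ← QuotientGroup.eq_one_iff]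
    rw [← QuotientGroup.eq_one_iff] at hc
    rw [← hc, ← QuotientGroup.mk'_apply, ← QuotientGroup.mk'_apply, map_commutatorElement,
      map_commutatorElement, map_mul, map_inv, QuotientGroup.mk'_apply N₁ n,
      (QuotientGroup.eq_one_iff n).2 hn, inv_one, mul_one]
  have hbN : (SemidirectProduct.inl b : PureFive) ∈ N := hM b
    (hcomm _ (by simpa [genD] using (Subgroup.mem_inf.1 h1).1))
    (hcomm _ (by simpa [genD, genE₁] using (Subgroup.mem_inf.1 h2).1))
  rw [hb] at hbN
  simpa using mul_mem hbN (hN₁ hn)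

instance finiteIndex_comap_conj_map_fibre (L : Subgroup PureFive) [L.FiniteIndex] :
    (((fibre ⊓ L).map toAut).comap (MulAut.conj : F2 →* _)).FiniteIndex := by
  have hle : ((fibre ⊓ L).map toAut).comap MulAut.conj ≤ innerFibre := by
    rw [innerFibre, ← map_fibre]
    exact Subgroup.comap_mono (Subgroup.map_mono inf_le_left)
  have h1 : (fibre ⊓ L).relIndex fibre ≠ 0 := by
    rw [inf_comm, Subgroup.inf_relIndex_right]
    exact (inferInstance : (L.subgroupOf fibre).FiniteIndex).index_ne_zero
  have h2 : ((fibre ⊓ L).map toAut).relIndex (fibre.map toAut) ≠ 0 := by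
    rw [← Subgroup.relIndex_comap]
    exact fun h => h1 (Subgroup.relIndex_eq_zero_of_le_left (Subgroup.le_comap_map _ _) h)
  have h3 : (((fibre ⊓ L).map toAut).comap MulAut.conj).relIndex innerFibre ≠ 0 := by
    rw [map_fibre] at h2
    exact Subgroup.relIndex_comap_ne_zero _ h2
  refine ⟨?_⟩
  rw [← Subgroup.relIndex_mul_index hle]
  exact mul_ne_zero h3 finiteIndex_innerFibre.index_ne_zero

/-- On an element of the fibre that acts as an inner automorphism, the commutator with an element
`g` is determined by the displacement of the inner element under `toAut g`, because `toAut` is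
injective on the fibre. -/
theorem commutator_mem_of_conj {L : Subgroup PureFive} {g p : PureFive} {f : F2} (hp : p ∈ fibre)
    (hf : toAut p = MulAut.conj f)
    (h : toAut g f * f⁻¹ ∈ ((fibre ⊓ L).map toAut).comap (MulAut.conj : F2 →* _)) : ⁅g, p⁆ ∈ L := by
  obtain ⟨q, hq, hqf⟩ := h
  have hgp : ⁅g, p⁆ ∈ fibre := mul_mem (normal_fibre.conj_mem p hp g) (inv_mem hp)
  have : toAut ⁅g, p⁆ = toAut q := by
    rw [hqf, map_mul, map_inv, map_commutatorElement, hf, commutatorElement_def, conj_apply_mul,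
      mul_inv_cancel_right]
  rw [toAut_injOn_fibre hgp (Subgroup.mem_inf.1 hq).1 this]
  exact (Subgroup.mem_inf.1 hq).2

theorem exists_toAut_eq_conj {p : PureFive}
    (hp : p ∈ ({genD ^ 2, genE₁ * genD ^ 2 * genE₁⁻¹, genS ^ 2, genT * genS ^ 2 * genT⁻¹} :
      Set PureFive)) : p ∈ fibre ∧ ∃ f, toAut p = MulAut.conj f := by
  have key : ∀ {p : PureFive} {f : F2} (g : PureFive), p ∈ fibre → toAut p = refl f →
      g * p ^ 2 * g⁻¹ ∈ fibre ∧ ∃ f, toAut (g * p ^ 2 * g⁻¹) = MulAut.conj f := by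
    intro p f g hp hf
    refine ⟨normal_fibre.conj_mem _ (pow_mem hp 2) g, toAut g (f * iota f), ?_⟩
    rw [map_mul, map_mul, map_pow, map_inv, hf, pow_two, refl_mul_refl, conj_apply_mul,
      mul_inv_cancel_right]
  rcases hp with rfl | rfl | rfl | rfl
  · simpa using key 1 genD_mem toAut_genD
  · exact key genE₁ genD_mem toAut_genD
  · simpa using key 1 genS_mem toAut_genS
  · exact key genT genS_mem toAut_genS

/-- The congruence subgroup property of the automorphism group of the free group of rank two. -/
theorem exists_normal_finiteIndex_forall_mem (H : Subgroup (MulAut F2)) [H.FiniteIndex] :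
    ∃ K : Subgroup F2, K.Normal ∧ K.FiniteIndex ∧
      ∀ σ : MulAut F2, (∀ g, σ g * g⁻¹ ∈ K) → σ ∈ H := by
  obtain ⟨L, hL, hLH⟩ := exists_finiteIndex_centralizer_le (H.normalCore.comap toAut)
  obtain ⟨K, hK, hKf, hKr⟩ := exists_congruence_le_range
  refine ⟨(((fibre ⊓ L).map toAut).comap (MulAut.conj : F2 →* _)).normalCore ⊓ K, inferInstance,
    inferInstance, fun σ hσ => ?_⟩
  obtain ⟨g, rfl⟩ := hKr σ fun f => (Subgroup.mem_inf.1 (hσ f)).2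
  refine Subgroup.normalCore_le H (hLH g fun p hp => ?_)
  obtain ⟨hpf, f, hf⟩ := exists_toAut_eq_conj hp
  exact commutator_mem_of_conj hpf hf
    (Subgroup.normalCore_le _ (Subgroup.mem_inf.1 (hσ f)).1)

end AutF2

/-! ### Injectivity on the profinite completion -/

theorem mem_congruenceSubgroup_of_forall {G : Type*} [Group G] {K : Subgroup G} [K.Normal]
    {σ : MulAut G} (h : ∀ g, ((σ g : G) : G ⧸ K) = (g : G ⧸ K)) : σ ∈ congruenceSubgroup K := by
  have hiff : ∀ g, σ g ∈ K ↔ g ∈ K := fun g => by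
    rw [← QuotientGroup.eq_one_iff, h, QuotientGroup.eq_one_iff]
  refine ⟨le_antisymm ?_ fun k hk => ?_, h⟩
  · rintro _ ⟨k, hk, rfl⟩
    exact (hiff k).2 hk
  · obtain ⟨l, rfl⟩ := σ.surjective k
    exact ⟨l, (hiff l).1 hk, rfl⟩

theorem isOpen_setOf_val_eq {G : Type u} [Group G]
    (U : FiniteIndexNormalSubgroup (GrpCat.of G)) (x : profiniteHat G) :
    IsOpen {y : profiniteHat G | y.val U = x.val U} := by
  have hc : Continuous fun y : profiniteHat G => y.val U :=
    (continuous_apply U).comp continuous_subtype_val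
  have : DiscreteTopology ((ProfiniteGrp.ProfiniteCompletion.diagram (GrpCat.of G)).obj U) := ⟨rfl⟩
  exact (isOpen_discrete {x.val U}).preimage hc

/-- If every subgroup of finite index of `Aut G` contains a congruence subgroup, then the natural
map from the profinite completion of `Aut G` is injective: an element of the kernel is approximated
by automorphisms which act trivially on a given finite quotient of `G`. -/
theorem hatAutToAutHat_injective {G : Type u} [Group G] [Group.FG G]
    (h : ∀ H : Subgroup (MulAut G), H.FiniteIndex →
      ∃ (K : Subgroup G) (_ : K.Normal), K.FiniteIndex ∧ congruenceSubgroup K ≤ H) :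
    Function.Injective (hatAutToAutHat G) := by
  rw [injective_iff_map_eq_one]
  intro x hx
  refine Subtype.ext (funext fun U => ?_)
  obtain ⟨K, hK, hKf, hKU⟩ := h U.toSubgroup U.isFiniteIndex'
  obtain ⟨S, hS⟩ := Group.fg_def.1 ‹Group.FG G›
  let K' : FiniteIndexNormalSubgroup (GrpCat.of G) := ⟨K, hK, hKf⟩
  have hV : IsOpen (⋂ s ∈ S, {y : profiniteHat (MulAut G) |
      (hatAutToAutHat G y (toProfiniteHat G s)).val K' = (toProfiniteHat G s).val K'}) := by
    refine isOpen_biInter_finset fun s _ => (isOpen_setOf_val_eq K' _).preimage ?_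
    exact ContinuousAut.continuous_eval.comp
      ((hatAutToAutHat G).continuous_toFun.prodMk continuous_const)
  obtain ⟨y, ⟨hy1, hy2⟩, σ, rfl⟩ := (toProfiniteHat_denseRange (MulAut G)).inter_open_nonempty _
    ((isOpen_setOf_val_eq U x).inter hV)
    ⟨x, rfl, Set.mem_iInter₂.2 fun s _ => by
      rw [Set.mem_ofPred_eq, hx]
      rfl⟩
  have hσ : ∀ g, ((σ g : G) : G ⧸ K) = (g : G ⧸ K) := by
    have : (QuotientGroup.mk' K).comp σ.toMonoidHom = QuotientGroup.mk' K := by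
      refine MonoidHom.eq_of_eqOn_dense hS fun s hs => ?_
      have h1 := Set.mem_iInter₂.1 hy2 s hs
      rwa [Set.mem_ofPred_eq, hatAutToAutHat_apply, autToAutHat_apply] at h1
    exact DFunLike.congr_fun this
  refine Eq.trans (Eq.symm hy1) ?_
  exact (QuotientGroup.eq_one_iff σ).2 (hKU (mem_congruenceSubgroup_of_forall hσ))

theorem mainTheorem2 :
    Function.Injective (hatAutToAutHat (FreeGroup (Fin 2))) ∧
    ∀ H : Subgroup (MulAut (FreeGroup (Fin 2))), H.FiniteIndex →
      ∃ (K : Subgroup (FreeGroup (Fin 2))) (_ : K.Normal),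
        K.FiniteIndex ∧ congruenceSubgroup K ≤ H := by
  have h : ∀ H : Subgroup (MulAut (FreeGroup (Fin 2))), H.FiniteIndex →
      ∃ (K : Subgroup (FreeGroup (Fin 2))) (_ : K.Normal),
        K.FiniteIndex ∧ congruenceSubgroup K ≤ H := by
    intro H hH
    obtain ⟨K, hK, hKf, hKH⟩ := AutF2.exists_normal_finiteIndex_forall_mem H
    refine ⟨K, hK, hKf, fun σ hσ => hKH σ fun g => ?_⟩
    rw [← div_eq_mul_inv, ← QuotientGroup.eq_iff_div_mem]
    exact hσ.2 g
  exact ⟨hatAutToAutHat_injective h, h⟩
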